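/- Consider undirected inhomogeneous Erdős–Rényi networks on $N$ nodes: $P\in[0,1]^{N\times N}$ is symmetric, and the adjacency matrix $A\in\{0,1\}^{N\times N}$ is symmetric with independent entries $A_{ij}\sim\mathrm{Bernoulli}(P_{ij})$, $i<j$ (the diagonal of $A$ may be any $\{0,1\}$-valued random variables, for instance $0$). Fix $n\le N$, partition $$P=\begin{pmatrix}P_{11}&P_{12}\\P_{21}&P_{22}\end{pmatrix},\qquad A=\begin{pmatrix}A_{11}&A_{12}\\A_{21}&A_{22}\end{pmatrix}$$ with $P_{11},A_{11}$ of size $n\times n$, and let $p^*=\max_{i,j}P_{ij}$. Write $\sigma_k(M)$ for the $k$-th largest singular value and $M^+$ for the Moore–Penrose inverse of a matrix $M$. The low-rank estimator (LE) with rank $K$ takes a singular value decomposition $A_{11}=UDV^T$ with the singular values in non-increasing order, sets $\tilde P_{11}=U_{(K)}D_{(K)}V_{(K)}^T$ (the first $K$ singular values and singular vectors), and returns $\hat P_{22}=A_{12}^T\tilde P_{11}^+A_{12}$. Theorem. Let $\psi,c_1,c_2>0$. There is a constant $C>0$, depending only on $\psi,c_1,c_2$, such that the following holds. Consider any sequence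 of such models with $N\to\infty$, where $n$, $P$ and $K\ge 1$ may vary along the sequence, such that 1. $\operatorname{rank}(P_{11})=\operatorname{rank}(P)=K$; 2. $\frac1\psi np^*\le\sigma_K(P_{11})\le\sigma_1(P_{11})\le\psi np^*$ and $\frac1\psi Np^*\le\sigma_K(P)\le\sigma_1(P)\le\psi Np^*$; 3. $np^*\ge c_1\log n$ and $K\le c_2\sqrt{\log n}$. Then, with probability tending to $1$ as $N\to\infty$, $$\|\hat P_{22}-P_{22}\|_F\le C\sqrt K\left(\Big(\frac Nn\Big)^{3/2}\sqrt{KNp^*}+\frac{N^2}{n^2}\log n\right)$$ (whichever singular value decomposition of $A_{11}$ is used), and the same bound holds when $\hat P_{22}$ is replaced by the matrix obtained from it by truncating all entries to $[0,1]$. -/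

import Mathlib

open MeasureTheory ProbabilityTheory Filter Topology
open scoped Matrix

namespace EgoLowRank

/-! ### Matrix notions -/

section Norm

attribute [local instance] Matrix.frobeniusNormedAddCommGroup

/-- The Frobenius norm of a real matrix. -/
noncomputable def frobeniusNorm {p q : ℕ} (M : Matrix (Fin p) (Fin q) ℝ) : ℝ := ‖M‖

end Norm

/-- The `k`-th largest singular value of `M`, for `k = 1, 2, …`
(Mathlib's sequence of singular values starts at index `0`). -/
noncomputable def singularValue {p q : ℕ} (k : ℕ) (M : Matrix (Fin p) (Fin q) ℝ) : ℝ :=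
  (Matrix.toEuclideanLin M).singularValues (k - 1)

/-- The largest entry of a square matrix. -/
noncomputable def maxEntry {N : ℕ} (M : Matrix (Fin N) (Fin N) ℝ) : ℝ :=
  ⨆ e : Fin N × Fin N, M e.1 e.2

/-- The block of the first `n` rows and the first `n` columns. -/
def block₁₁ {n m : ℕ} (M : Matrix (Fin (n + m)) (Fin (n + m)) ℝ) : Matrix (Fin n) (Fin n) ℝ :=
  M.submatrix (Fin.castAdd m) (Fin.castAdd m)

/-- The block of the first `n` rows and the last `m` columns. -/
def block₁₂ {n m : ℕ} (M : Matrix (Fin (n + m)) (Fin (n + m)) ℝ) : Matrix (Fin n) (Fin m) ℝ :=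
  M.submatrix (Fin.castAdd m) (Fin.natAdd n)

/-- The block of the last `m` rows and the last `m` columns. -/
def block₂₂ {n m : ℕ} (M : Matrix (Fin (n + m)) (Fin (n + m)) ℝ) : Matrix (Fin m) (Fin m) ℝ :=
  M.submatrix (Fin.natAdd n) (Fin.natAdd n)

/-- `X` is the Moore–Penrose inverse of the real matrix `M` (the four Penrose equations). -/
structure IsMoorePenrose {p q : ℕ} (M : Matrix (Fin p) (Fin q) ℝ)
    (X : Matrix (Fin q) (Fin p) ℝ) : Prop where
  mul_mul_self : M * X * M = M
  self_mul_mul : X * M * X = X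
  mul_symm : (M * X)ᵀ = M * X
  symm_mul : (X * M)ᵀ = X * M

theorem IsMoorePenrose.unique {p q : ℕ} {M : Matrix (Fin p) (Fin q) ℝ}
    {X Y : Matrix (Fin q) (Fin p) ℝ} (hX : IsMoorePenrose M X) (hY : IsMoorePenrose M Y) :
    X = Y := by
  have h1 : M * X = M * Y := by
    calc M * X = (M * X)ᵀ := hX.mul_symm.symm
      _ = ((M * Y) * (M * X))ᵀ := by
          rw [← Matrix.mul_assoc, hY.mul_mul_self]
      _ = (M * X) * (M * Y) := by
          rw [Matrix.transpose_mul, hX.mul_symm, hY.mul_symm]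
      _ = M * Y := by rw [← Matrix.mul_assoc, hX.mul_mul_self]
  have h2 : X * M = Y * M := by
    calc X * M = (X * M)ᵀ := hX.symm_mul.symm
      _ = ((X * M) * (Y * M))ᵀ := by
          rw [Matrix.mul_assoc, ← Matrix.mul_assoc M Y M, hY.mul_mul_self]
      _ = (Y * M) * (X * M) := by
          rw [Matrix.transpose_mul, hX.symm_mul, hY.symm_mul]
      _ = Y * M := by rw [Matrix.mul_assoc, ← Matrix.mul_assoc M X M, hX.mul_mul_self]
  calc X = X * M * X := hX.self_mul_mul.symm
    _ = Y * M * Y := by rw [h2, Matrix.mul_assoc, h1, ← Matrix.mul_assoc]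
    _ = Y := hY.self_mul_mul

theorem exists_isMoorePenrose {p q : ℕ} (M : Matrix (Fin p) (Fin q) ℝ) :
    ∃ X, IsMoorePenrose M X := by
  have hB : (Mᵀ * M).IsHermitian := by
    simp [Matrix.IsHermitian, Matrix.conjTranspose_eq_transpose_of_trivial]
  obtain ⟨Q, d, hQ, hQ', hd⟩ : ∃ (Q : Matrix (Fin q) (Fin q) ℝ) (d : Fin q → ℝ),
      Qᵀ * Q = 1 ∧ Q * Qᵀ = 1 ∧ Mᵀ * M = Q * Matrix.diagonal d * Qᵀ := by
    refine ⟨hB.eigenvectorUnitary, hB.eigenvalues, ?_, ?_, ?_⟩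
    · simpa [Matrix.star_eq_conjTranspose] using
        Unitary.coe_star_mul_self hB.eigenvectorUnitary
    · simpa [Matrix.star_eq_conjTranspose] using
        Unitary.coe_mul_star_self hB.eigenvectorUnitary
    · simpa [Unitary.conjStarAlgAut_apply, Matrix.star_eq_conjTranspose,
        Function.comp_def] using hB.spectral_theorem
  set B := Mᵀ * M with hBdef
  set Z := Q * Matrix.diagonal (fun i => (d i)⁻¹) * Qᵀ with hZ
  have key : ∀ a b : Fin q → ℝ, (Q * Matrix.diagonal a * Qᵀ) * (Q * Matrix.diagonal b * Qᵀ)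
      = Q * Matrix.diagonal (fun i => a i * b i) * Qᵀ := by
    intro a b
    calc _ = Q * Matrix.diagonal a * (Qᵀ * Q) * Matrix.diagonal b * Qᵀ := by
          simp only [Matrix.mul_assoc]
      _ = _ := by rw [hQ, Matrix.mul_one, Matrix.mul_assoc Q, Matrix.diagonal_mul_diagonal]
  have tr : ∀ a : Fin q → ℝ, (Q * Matrix.diagonal a * Qᵀ)ᵀ = Q * Matrix.diagonal a * Qᵀ := by
    intro a
    simp [Matrix.transpose_mul, Matrix.mul_assoc]
  have hZB : Z * B = Q * Matrix.diagonal (fun i => (d i)⁻¹ * d i) * Qᵀ := by rw [hd, hZ, key]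
  have hZBZ : Z * B * Z = Z := by
    rw [hZB, hZ, key]
    congr 3
    funext i
    by_cases h : d i = 0 <;> simp [h]
  have hBZB : B * (Z * B) = B := by
    rw [hZB, hd, key]
    congr 3
    funext i
    by_cases h : d i = 0 <;> simp [h]
  have hZBt : (Z * B)ᵀ = Z * B := by rw [hZB, tr]
  have hZt : Zᵀ = Z := by rw [hZ, tr]
  have hMZB : M * (Z * B) = M := by
    have h0 : (M * (Z * B - 1))ᵀ * (M * (Z * B - 1)) = 0 := by
      rw [Matrix.transpose_mul, Matrix.mul_assoc, ← Matrix.mul_assoc Mᵀ, ← hBdef,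
        Matrix.mul_sub, hBZB, Matrix.mul_one, sub_self, Matrix.mul_zero]
    have h1 : M * (Z * B - 1) = 0 := by
      rw [← Matrix.conjTranspose_eq_transpose_of_trivial,
        Matrix.conjTranspose_mul_self_eq_zero] at h0
      exact h0
    rw [Matrix.mul_sub, Matrix.mul_one] at h1
    exact sub_eq_zero.mp h1
  refine ⟨Z * Mᵀ, ?_, ?_, ?_, ?_⟩
  · calc M * (Z * Mᵀ) * M = M * (Z * B) := by simp only [hBdef, Matrix.mul_assoc]
      _ = M := hMZB
  · calc Z * Mᵀ * M * (Z * Mᵀ) = (Z * B * Z) * Mᵀ := by simp only [hBdef, Matrix.mul_assoc]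
      _ = Z * Mᵀ := by rw [hZBZ]
  · rw [Matrix.transpose_mul, Matrix.transpose_mul, Matrix.transpose_transpose, hZt,
      Matrix.mul_assoc]
  · have : Z * Mᵀ * M = Z * B := by simp only [hBdef, Matrix.mul_assoc]
    rw [this, hZBt]

/-- The Moore–Penrose inverse `M⁺` of a real matrix. -/
noncomputable def moorePenrose {p q : ℕ} (M : Matrix (Fin p) (Fin q) ℝ) :
    Matrix (Fin q) (Fin p) ℝ :=
  (exists_isMoorePenrose M).choose

theorem isMoorePenrose_moorePenrose {p q : ℕ} (M : Matrix (Fin p) (Fin q) ℝ) :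
    IsMoorePenrose M (moorePenrose M) :=
  (exists_isMoorePenrose M).choose_spec

/-- `M = U D Vᵀ` is a singular value decomposition of the square matrix `M`: `U` and `V` are
orthogonal, and `D` is the diagonal matrix of the nonnegative numbers `d`, in non-increasing
order. -/
structure IsSVD {n : ℕ} (M U : Matrix (Fin n) (Fin n) ℝ) (d : Fin n → ℝ)
    (V : Matrix (Fin n) (Fin n) ℝ) : Prop where
  left_mem : U ∈ Matrix.orthogonalGroup (Fin n) ℝ
  right_mem : V ∈ Matrix.orthogonalGroup (Fin n) ℝ
  nonneg : ∀ i, 0 ≤ d i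
  antitone : Antitone d
  eq_mul : M = U * Matrix.diagonal d * Vᵀ

/-- Every symmetric matrix has a singular value decomposition. -/
theorem exists_isSVD_of_isSymm {n : ℕ} {M : Matrix (Fin n) (Fin n) ℝ} (hM : M.IsSymm) :
    ∃ U d V, IsSVD M U d V := by
  have hH : M.IsHermitian := by
    rw [Matrix.IsHermitian, Matrix.conjTranspose_eq_transpose_of_trivial]; exact hM
  obtain ⟨Q, a, hQ, hQa⟩ : ∃ (Q : Matrix (Fin n) (Fin n) ℝ) (a : Fin n → ℝ),
      Qᵀ * Q = 1 ∧ M = Q * Matrix.diagonal a * Qᵀ := by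
    refine ⟨hH.eigenvectorUnitary, hH.eigenvalues, ?_, ?_⟩
    · simpa [Matrix.star_eq_conjTranspose] using
        Unitary.coe_star_mul_self hH.eigenvectorUnitary
    · simpa [Unitary.conjStarAlgAut_apply, Matrix.star_eq_conjTranspose,
        Function.comp_def] using hH.spectral_theorem
  let s := Tuple.sort fun i => -|a i|
  have hs : Monotone ((fun i => -|a i|) ∘ s) := Tuple.monotone_sort _
  let ε : Fin n → ℝ := fun i => if 0 ≤ a i then 1 else -1
  have hε : ∀ i, ε i * ε i = 1 := fun i => by by_cases h : 0 ≤ a i <;> simp [ε, h]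
  have hεa : ∀ i, |a i| * ε i = a i := fun i => by
    by_cases h : 0 ≤ a i
    · simp [ε, h, abs_of_nonneg h]
    · simp [ε, h, abs_of_neg (not_le.mp h)]
  have hq : ∀ i j, ∑ k, Q k i * Q k j = if i = j then 1 else 0 := fun i j => by
    simpa [Matrix.mul_apply, Matrix.one_apply] using congrFun (congrFun hQ i) j
  refine ⟨Q.submatrix id s, fun i => |a (s i)|,
    Matrix.of fun i j => Q i (s j) * ε (s j), ?_, ?_, ?_, ?_, ?_⟩
  · rw [Matrix.mem_orthogonalGroup_iff']
    ext i j
    simp [Matrix.mul_apply, Matrix.one_apply, hq]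
  · rw [Matrix.mem_orthogonalGroup_iff']
    ext i j
    have : ∀ k, Q k (s i) * ε (s i) * (Q k (s j) * ε (s j))
        = (ε (s i) * ε (s j)) * (Q k (s i) * Q k (s j)) := fun k => by ring
    rw [Matrix.mul_apply, Matrix.one_apply]
    change ∑ k, Q k (s i) * ε (s i) * (Q k (s j) * ε (s j)) = _
    rw [Finset.sum_congr rfl fun k _ => this k, ← Finset.mul_sum, hq]
    by_cases h : i = j
    · simp [h, hε]
    · simp [h]
  · exact fun i => abs_nonneg _
  · exact fun i j hij => neg_le_neg_iff.mp (hs hij)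
  · rw [hQa]
    ext i j
    rw [Matrix.mul_apply, Matrix.mul_apply]
    simp only [Matrix.mul_diagonal, Matrix.transpose_apply, Matrix.submatrix_apply,
      Matrix.of_apply, id]
    rw [← Equiv.sum_comp s]
    refine Finset.sum_congr rfl fun k _ => ?_
    calc Q i (s k) * a (s k) * Q j (s k)
        = Q i (s k) * (|a (s k)| * ε (s k)) * Q j (s k) := by rw [hεa]
      _ = Q i (s k) * |a (s k)| * (Q j (s k) * ε (s k)) := by ring

/-- The truncation `U₍K₎ D₍K₎ V₍K₎ᵀ` of a singular value decomposition `U D Vᵀ`, which keeps the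
first `K` singular values and singular vectors. -/
def truncatedSVD {n : ℕ} (K : ℕ) (U : Matrix (Fin n) (Fin n) ℝ) (d : Fin n → ℝ)
    (V : Matrix (Fin n) (Fin n) ℝ) : Matrix (Fin n) (Fin n) ℝ :=
  U * Matrix.diagonal (fun i : Fin n => if (i : ℕ) < K then d i else 0) * Vᵀ

/-- `R` is an output of the low-rank estimation procedure with rank `K` on the observed blocks
`A₁₁` and `A₁₂`: `R = A₁₂ᵀ P̃₁₁⁺ A₁₂`, where `P̃₁₁` is the rank-`K` truncation of some singular value
decomposition of `A₁₁`. -/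
def IsLowRankEstimate {n m : ℕ} (K : ℕ) (A₁₁ : Matrix (Fin n) (Fin n) ℝ)
    (A₁₂ : Matrix (Fin n) (Fin m) ℝ) (R : Matrix (Fin m) (Fin m) ℝ) : Prop :=
  ∃ (U : Matrix (Fin n) (Fin n) ℝ) (d : Fin n → ℝ) (V : Matrix (Fin n) (Fin n) ℝ),
    IsSVD A₁₁ U d V ∧ R = A₁₂ᵀ * moorePenrose (truncatedSVD K U d V) * A₁₂

/-- Entrywise truncation to `[0, 1]`. -/
def clip {m : ℕ} (R : Matrix (Fin m) (Fin m) ℝ) : Matrix (Fin m) (Fin m) ℝ :=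
  R.map fun x => max 0 (min 1 x)

/-! ### The random network model -/

/-- The random matrix `A` is the adjacency matrix of an undirected inhomogeneous Erdős–Rényi network
with symmetric probability matrix `P`: `A` is symmetric with entries in `{0, 1}`, and its entries
above the diagonal are independent, `A i j` having the Bernoulli law with parameter `P i j`.
The diagonal entries of `A` are arbitrary `{0, 1}`-valued random variables (in particular, they may
all be `0`). -/
structure IsInhomogeneousErdosRenyi {N : ℕ} {Ω : Type*} [MeasurableSpace Ω] (μ : Measure Ω)
    (P : Matrix (Fin N) (Fin N) ℝ) (A : Ω → Matrix (Fin N) (Fin N) ℝ) : Prop where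
  prob_symm : P.IsSymm
  prob_mem : ∀ i j, P i j ∈ unitInterval
  measurable : ∀ i j, Measurable fun ω => A ω i j
  adj_symm : ∀ ω, (A ω).IsSymm
  adj_mem : ∀ ω i j, A ω i j = 0 ∨ A ω i j = 1
  law : ∀ i j, i < j → HasLaw (fun ω => A ω i j) (bernoulliMeasure 1 0 ⟨P i j, prob_mem i j⟩) μ
  indep : iIndepFun (fun (e : {e : Fin N × Fin N // e.1 < e.2}) ω => A ω e.1.1 e.1.2) μ

/-- The well-conditioning assumption with constant `ψ`: the `K`-th and the largest singular value of
the leading `n × n` block of `P` are within the factor `ψ` of `n p*`, and those of `P` are within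
the factor `ψ` of `N p*`, where `N = n + m` and `p*` is the largest entry of `P`. -/
structure IsWellConditioned {n m : ℕ} (ψ : ℝ) (K : ℕ)
    (P : Matrix (Fin (n + m)) (Fin (n + m)) ℝ) : Prop where
  lower₁₁ : 1 / ψ * ((n : ℝ) * maxEntry P) ≤ singularValue K (block₁₁ P)
  upper₁₁ : singularValue 1 (block₁₁ P) ≤ ψ * ((n : ℝ) * maxEntry P)
  lower : 1 / ψ * (((n + m : ℕ) : ℝ) * maxEntry P) ≤ singularValue K P
  upper : singularValue 1 P ≤ ψ * (((n + m : ℕ) : ℝ) * maxEntry P)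

/-- The rate `√K ((N/n)^{3/2} √(K N p) + (N²/n²) log n)`. -/
noncomputable def rate (N n K : ℕ) (p : ℝ) : ℝ :=
  √(K : ℝ) * (((N : ℝ) / n) ^ (3 / 2 : ℝ) * √((K : ℝ) * N * p)
    + (N : ℝ) ^ 2 / (n : ℝ) ^ 2 * Real.log n)

end EgoLowRank

/-!
# Consistency of the low-rank estimator

Write `A₁₁ = P₁₁ + E₁₁` and `A₁₂ = P₁₂ + E₁₂`, and let `p` be the largest entry of `P`;
norms of matrices are `ℓ²` operator norms unless said otherwise. The proof has a deterministic part and a probabilistic part.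

**Deterministic part.** Because the leading block has the full rank of `P`, there is a matrix `Z`
with `P₁₂ = P₁₁ Z` and `P₂₂ = Zᵀ P₁₁ Z`, and `‖Z‖ = O(√(N / n))` as the `K`-th singular value of
`P₁₁` is of order `n p` (`exists_block_factorization`). Weyl's inequalities show that the
truncation of `A₁₁` differs from `P₁₁` by at most `2 ‖E₁₁‖`, and that its pseudoinverse has norm
`O(1 / (n p))` if `‖E₁₁‖` is small compared to `n p`. Expanding `A₁₂ᵀ P̃₁₁⁺ A₁₂ - Zᵀ P₁₁ Z` with
`A₁₂ = P₁₁ Z + E₁₂` bounds the operator norm of the error (`norm_quadratic_sub_le`), and since the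
error has rank at most `2 K`, its Frobenius norm is larger by a factor `√(2 K)` at most. When
`‖E₁₁‖ = O(√(n p))` and `‖E₁₂‖ = O(√(N p))` this gives the rate (`frobeniusNorm_estimate_sub_le`).

**Probabilistic part.** The bounds `‖E₁₁‖ = O(√(n p))` and `‖E₁₂‖ = O(√(N p))`, without any
logarithmic loss although `n p` may be as small as `c₁ log n`, come from the moment method. The
expected trace of the `2 k`-th power of the centred adjacency matrix on `N` vertices is a sum over
closed walks, in which only the walks that traverse no edge exactly once contribute, and those on
`v` vertices contribute at most `p ^ (v - 1)`. Grouping the walks by their pattern of coincidences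
compares this sum with the number of such walks on only `2 k` vertices, as long as `N p ≤ k`
(`sum_recurrentWalk_le`). That number is in turn at most the expected trace of a power of a
`2 k × 2 k` symmetric matrix with bounded centred entries all of whose moments of order at least two are
at least one, and for such a matrix, with as many rows as the order of the moment, a net argument
is sharp enough: the number is at most `(C k) ^ k` (`card_recurrentWalk_le_pow`). Markov's
inequality with `k` of the order of `N p ≥ c log N` concludes
(`IsInhomogeneousErdosRenyi.measure_lt_norm_sub_le`).

The size `n` of the observed block need not tend to infinity with `N`, so that the failure
probability `O(1 / n)` need not tend to zero. For each fixed `n`, however, the bound holds surely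
for all large `N`: its right-hand side grows like `N ^ 2`, while the error is `O(N)` because there
are only finitely many possible matrices `A₁₁`
(`exists_forall_frobeniusNorm_estimate_sub_le_rate`).
-/

namespace EgoLowRank

/-! ### Frobenius norm and operator norm -/

section LinearAlgebra

open scoped Matrix.Norms.L2Operator

theorem norm_toEuclideanLin_le {p q : ℕ} (M : Matrix (Fin p) (Fin q) ℝ)
    (x : EuclideanSpace ℝ (Fin q)) : ‖Matrix.toEuclideanLin M x‖ ≤ ‖M‖ * ‖x‖ :=
  Matrix.l2_opNorm_mulVec M x

theorem opNorm_le_of_forall {p q : ℕ} (M : Matrix (Fin p) (Fin q) ℝ) {c : ℝ} (hc : 0 ≤ c)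
    (h : ∀ x, ‖Matrix.toEuclideanLin M x‖ ≤ c * ‖x‖) : ‖M‖ ≤ c :=
  ContinuousLinearMap.opNorm_le_bound _ hc h

theorem toEuclideanLin_mul {p q r : ℕ} (M : Matrix (Fin p) (Fin q) ℝ)
    (M' : Matrix (Fin q) (Fin r) ℝ) (x : EuclideanSpace ℝ (Fin r)) :
    Matrix.toEuclideanLin (M * M') x = Matrix.toEuclideanLin M (Matrix.toEuclideanLin M' x) := by
  ext i
  simp [Matrix.mulVec_mulVec]

theorem opNorm_transpose {p q : ℕ} (M : Matrix (Fin p) (Fin q) ℝ) : ‖Mᵀ‖ = ‖M‖ := by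
  rw [← Matrix.conjTranspose_eq_transpose_of_trivial, Matrix.l2_opNorm_conjTranspose]

theorem frobeniusNorm_nonneg {p q : ℕ} (M : Matrix (Fin p) (Fin q) ℝ) : 0 ≤ frobeniusNorm M := by
  let := @Matrix.frobeniusNormedAddCommGroup (Fin p) (Fin q) ℝ _ _ _
  exact norm_nonneg M

theorem frobeniusNorm_sq {p q : ℕ} (M : Matrix (Fin p) (Fin q) ℝ) :
    frobeniusNorm M ^ 2 = ∑ i, ∑ j, M i j ^ 2 := by
  have h : frobeniusNorm M = (∑ i, ∑ j, ‖M i j‖ ^ (2 : ℝ)) ^ (1 / 2 : ℝ) :=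
    Matrix.frobenius_norm_def M
  rw [h, ← Real.sqrt_eq_rpow, Real.sq_sqrt (by positivity)]
  simp

theorem frobeniusNorm_sq_eq_trace {p q : ℕ} (M : Matrix (Fin p) (Fin q) ℝ) :
    frobeniusNorm M ^ 2 = (Mᵀ * M).trace := by
  rw [frobeniusNorm_sq, Finset.sum_comm]
  simp [Matrix.trace, Matrix.mul_apply, sq]

theorem opNorm_le_frobeniusNorm {p q : ℕ} (M : Matrix (Fin p) (Fin q) ℝ) :
    ‖M‖ ≤ frobeniusNorm M := by
  refine opNorm_le_of_forall M (frobeniusNorm_nonneg M) fun x => ?_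
  refine le_of_sq_le_sq ?_ (mul_nonneg (frobeniusNorm_nonneg M) (norm_nonneg _))
  rw [mul_pow, frobeniusNorm_sq, EuclideanSpace.real_norm_sq_eq, EuclideanSpace.real_norm_sq_eq,
    Finset.sum_mul]
  refine Finset.sum_le_sum fun i _ => ?_
  simpa [Matrix.toLpLin_apply, Matrix.mulVec, dotProduct] using
    Finset.sum_mul_sq_le_sq_mul_sq Finset.univ (M i) x

theorem frobeniusNorm_le_of_entries {p q : ℕ} (M : Matrix (Fin p) (Fin q) ℝ) {b : ℝ}
    (hb : 0 ≤ b) (h : ∀ i j, |M i j| ≤ b) : frobeniusNorm M ≤ √(p * q) * b := by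
  refine le_of_sq_le_sq ?_ (by positivity)
  rw [frobeniusNorm_sq, mul_pow, Real.sq_sqrt (by positivity)]
  calc ∑ i, ∑ j, M i j ^ 2 ≤ ∑ _i : Fin p, ∑ _j : Fin q, b ^ 2 :=
        Finset.sum_le_sum fun i _ => Finset.sum_le_sum fun j _ =>
          sq_le_sq' (abs_le.mp (h i j)).1 (abs_le.mp (h i j)).2
    _ = p * q * b ^ 2 := by simp [mul_assoc]

theorem frobeniusNorm_le_sqrt_rank_mul {p q : ℕ} (M : Matrix (Fin p) (Fin q) ℝ) :
    frobeniusNorm M ≤ √(M.rank : ℝ) * ‖M‖ := by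
  refine le_of_sq_le_sq ?_ (by positivity)
  have hH : (Mᵀ * M).IsHermitian := by
    simp [Matrix.IsHermitian, Matrix.conjTranspose_eq_transpose_of_trivial]
  have heig : ∀ i, hH.eigenvalues i ≤ ‖M‖ ^ 2 := by
    intro i
    set v := hH.eigenvectorBasis i
    have hv : ‖v‖ = 1 := hH.eigenvectorBasis.orthonormal.1 i
    have h1 : Matrix.toEuclideanLin (Mᵀ * M) v = hH.eigenvalues i • v := by
      ext j
      simpa [Matrix.toLpLin_apply] using congrFun (hH.mulVec_eigenvectorBasis i) j
    have h2 := norm_toEuclideanLin_le (Mᵀ * M) v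
    have h3 := Matrix.l2_opNorm_conjTranspose_mul_self M
    rw [Matrix.conjTranspose_eq_transpose_of_trivial] at h3
    rw [h1, norm_smul, hv, h3, Real.norm_eq_abs] at h2
    have := le_abs_self (hH.eigenvalues i)
    nlinarith
  rw [frobeniusNorm_sq_eq_trace, hH.trace_eq_sum_eigenvalues, mul_pow,
    Real.sq_sqrt (by positivity), ← Matrix.rank_transpose_mul_self,
    hH.rank_eq_card_non_zero_eigs, Fintype.card_subtype]
  simp only [RCLike.ofReal_real_eq_id, id]
  rw [← Finset.sum_filter_add_sum_filter_not Finset.univ (fun i => hH.eigenvalues i ≠ 0)]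
  have h0 : ∑ i with ¬ hH.eigenvalues i ≠ 0, hH.eigenvalues i = 0 :=
    Finset.sum_eq_zero fun i hi => by simpa using hi
  rw [h0, add_zero, ← nsmul_eq_mul]
  exact Finset.sum_le_card_nsmul _ _ _ fun i _ => heig i

theorem frobeniusNorm_clip_sub_le {m : ℕ} (R Q : Matrix (Fin m) (Fin m) ℝ)
    (hQ : ∀ i j, Q i j ∈ unitInterval) :
    frobeniusNorm (clip R - Q) ≤ frobeniusNorm (R - Q) := by
  refine le_of_sq_le_sq ?_ (frobeniusNorm_nonneg _)
  rw [frobeniusNorm_sq, frobeniusNorm_sq]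
  refine Finset.sum_le_sum fun i _ => Finset.sum_le_sum fun j _ => ?_
  rw [sq_le_sq]
  obtain ⟨h0, h1⟩ := hQ i j
  simp only [clip, Matrix.sub_apply, Matrix.map_apply]
  rcases le_total (R i j) 1 with h | h
  · rw [min_eq_right h]
    rcases le_total 0 (R i j) with h' | h'
    · rw [max_eq_right h']
    · rw [max_eq_left h', abs_of_nonpos (by linarith), abs_of_nonpos (by linarith)]
      linarith
  · rw [min_eq_left h, max_eq_right zero_le_one, abs_of_nonneg (by linarith),
      abs_of_nonneg (by linarith)]
    linarith

theorem opNorm_diagonal_le {n : ℕ} (v : Fin n → ℝ) {c : ℝ} (hc : 0 ≤ c) (h : ∀ i, |v i| ≤ c) :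
    ‖Matrix.diagonal v‖ ≤ c := by
  rw [Matrix.l2_opNorm_diagonal]
  exact (pi_norm_le_iff_of_nonneg hc).mpr h

theorem opNorm_le_one_of_symm_of_idem {n : ℕ} {Q : Matrix (Fin n) (Fin n) ℝ}
    (h1 : Qᵀ = Q) (h2 : Q * Q = Q) : ‖Q‖ ≤ 1 := by
  refine IsStarProjection.norm_le Q ⟨h2, ?_⟩
  rw [IsSelfAdjoint, Matrix.star_eq_conjTranspose, Matrix.conjTranspose_eq_transpose_of_trivial, h1]

theorem opNorm_le_one_of_mem_orthogonalGroup {n : ℕ} {Q : Matrix (Fin n) (Fin n) ℝ}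
    (h : Q ∈ Matrix.orthogonalGroup (Fin n) ℝ) : ‖Q‖ ≤ 1 := by
  have h' := (Matrix.mem_orthogonalGroup_iff' _ _).mp h
  have h2 := Matrix.l2_opNorm_conjTranspose_mul_self Q
  have h3 : ‖(1 : Matrix (Fin n) (Fin n) ℝ)‖ ≤ 1 :=
    opNorm_le_one_of_symm_of_idem (by simp) (by simp)
  rw [Matrix.conjTranspose_eq_transpose_of_trivial, show Qᵀ * Q = 1 from h'] at h2
  nlinarith [norm_nonneg Q]

/-! ### Perturbation of singular values -/

theorem norm_toEuclideanLin_of_mem_orthogonalGroup {n : ℕ} {Q : Matrix (Fin n) (Fin n) ℝ}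
    (h : Q ∈ Matrix.orthogonalGroup (Fin n) ℝ) (x : EuclideanSpace ℝ (Fin n)) :
    ‖Matrix.toEuclideanLin Q x‖ = ‖x‖ := by
  have hT : Qᵀ ∈ Matrix.orthogonalGroup (Fin n) ℝ := by
    rw [Matrix.mem_orthogonalGroup_iff]
    simpa [Matrix.star_eq_conjTranspose, Matrix.conjTranspose_eq_transpose_of_trivial] using
      (Matrix.mem_orthogonalGroup_iff' _ _).mp h
  refine le_antisymm ?_ ?_
  · exact (norm_toEuclideanLin_le Q x).trans
      (mul_le_of_le_one_left (norm_nonneg _) (opNorm_le_one_of_mem_orthogonalGroup h))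
  · have h1 : Matrix.toEuclideanLin Qᵀ (Matrix.toEuclideanLin Q x) = x := by
      have h' : Qᵀ * Q = 1 := (Matrix.mem_orthogonalGroup_iff' _ _).mp h
      rw [← toEuclideanLin_mul, h']
      ext i
      simp
    calc ‖x‖ = ‖Matrix.toEuclideanLin Qᵀ (Matrix.toEuclideanLin Q x)‖ := by rw [h1]
      _ ≤ ‖Qᵀ‖ * ‖Matrix.toEuclideanLin Q x‖ := norm_toEuclideanLin_le _ _
      _ ≤ _ := mul_le_of_le_one_left (norm_nonneg _) (opNorm_le_one_of_mem_orthogonalGroup hT)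

theorem IsSVD.transpose_right_mem {n : ℕ} {M U V : Matrix (Fin n) (Fin n) ℝ} {d : Fin n → ℝ}
    (h : IsSVD M U d V) : Vᵀ ∈ Matrix.orthogonalGroup (Fin n) ℝ := by
  rw [Matrix.mem_orthogonalGroup_iff]
  simpa [Matrix.star_eq_conjTranspose, Matrix.conjTranspose_eq_transpose_of_trivial] using
    (Matrix.mem_orthogonalGroup_iff' _ _).mp h.right_mem

theorem IsSVD.norm_toEuclideanLin_sq {n : ℕ} {M U V : Matrix (Fin n) (Fin n) ℝ} {d : Fin n → ℝ}
    (h : IsSVD M U d V) (x : EuclideanSpace ℝ (Fin n)) :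
    ‖Matrix.toEuclideanLin M x‖ ^ 2 = ∑ j, (d j * Matrix.toEuclideanLin Vᵀ x j) ^ 2 := by
  rw [h.eq_mul, toEuclideanLin_mul, toEuclideanLin_mul,
    norm_toEuclideanLin_of_mem_orthogonalGroup h.left_mem, EuclideanSpace.real_norm_sq_eq]
  simp only [Matrix.toLpLin_apply, Matrix.mulVec_diagonal]

/-- A subspace whose dimension exceeds the number of prescribed coordinates contains a nonzero
vector all of whose prescribed coordinates vanish. -/
theorem exists_ne_zero_mem_of_card_lt {n : ℕ} (W : Submodule ℝ (EuclideanSpace ℝ (Fin n)))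
    (Q : Matrix (Fin n) (Fin n) ℝ) (J : Finset (Fin n)) (hJ : J.card < Module.finrank ℝ W) :
    ∃ x ∈ W, x ≠ 0 ∧ ∀ j ∈ J, Matrix.toEuclideanLin Q x j = 0 := by
  let f : W →ₗ[ℝ] (J → ℝ) :=
    { toFun := fun x j => Matrix.toEuclideanLin Q x j
      map_add' := fun x y => by ext j; simp
      map_smul' := fun c x => by ext j; simp }
  have hf : LinearMap.ker f ≠ ⊥ := LinearMap.ker_ne_bot_of_finrank_lt (by simpa using hJ)
  obtain ⟨x, hx, hx0⟩ := (Submodule.ne_bot_iff _).mp hf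
  exact ⟨x, x.2, by simpa using hx0, fun j hj => congrFun (LinearMap.mem_ker.mp hx) ⟨j, hj⟩⟩

/-- Weyl's inequality from below, for the given singular value decomposition of `A`. -/
theorem IsSVD.sub_le_of_subspace {n : ℕ} {A B U V : Matrix (Fin n) (Fin n) ℝ} {d : Fin n → ℝ}
    (h : IsSVD A U d V) {s : ℝ} (W : Submodule ℝ (EuclideanSpace ℝ (Fin n)))
    (hW : ∀ x ∈ W, s * ‖x‖ ≤ ‖Matrix.toEuclideanLin B x‖) (i : Fin n)
    (hi : (i : ℕ) < Module.finrank ℝ W) : s - ‖A - B‖ ≤ d i := by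
  obtain ⟨x, hxW, hx0, hx⟩ := exists_ne_zero_mem_of_card_lt W Vᵀ (Finset.Iio i) (by simpa using hi)
  have hxpos : 0 < ‖x‖ := norm_pos_iff.mpr hx0
  have h1 : ‖Matrix.toEuclideanLin A x‖ ≤ d i * ‖x‖ := by
    refine le_of_sq_le_sq ?_ (mul_nonneg (h.nonneg i) hxpos.le)
    rw [h.norm_toEuclideanLin_sq, mul_pow,
      ← norm_toEuclideanLin_of_mem_orthogonalGroup h.transpose_right_mem x,
      EuclideanSpace.real_norm_sq_eq, Finset.mul_sum]
    refine Finset.sum_le_sum fun j _ => ?_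
    rw [mul_pow]
    rcases lt_or_ge j i with hj | hj
    · simp [hx j (Finset.mem_Iio.mpr hj)]
    · exact mul_le_mul_of_nonneg_right
        (pow_le_pow_left₀ (h.nonneg j) (h.antitone hj) 2) (sq_nonneg _)
  have h2 : ‖Matrix.toEuclideanLin B x‖ ≤ ‖Matrix.toEuclideanLin A x‖ + ‖A - B‖ * ‖x‖ := by
    have h3 := norm_toEuclideanLin_le (A - B) x
    rw [map_sub, LinearMap.sub_apply] at h3
    have := norm_le_norm_add_norm_sub (Matrix.toEuclideanLin A x) (Matrix.toEuclideanLin B x)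
    linarith
  have h4 := hW x hxW
  have : (s - ‖A - B‖) * ‖x‖ ≤ d i * ‖x‖ := by linarith
  exact le_of_mul_le_mul_right this hxpos

theorem finrank_range_toEuclideanLin {p q : ℕ} (B : Matrix (Fin p) (Fin q) ℝ) :
    Module.finrank ℝ (LinearMap.range (Matrix.toEuclideanLin B)) = B.rank := by
  rw [Matrix.rank_eq_finrank_range_toLin B (EuclideanSpace.basisFun (Fin p) ℝ).toBasis
      (EuclideanSpace.basisFun (Fin q) ℝ).toBasis, Matrix.toEuclideanLin_eq_toLin_orthonormal]

/-- The singular values of `A` past the rank of `B` are at most `‖A - B‖`. -/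
theorem IsSVD.le_norm_sub_of_rank_le {n : ℕ} {A B U V : Matrix (Fin n) (Fin n) ℝ} {d : Fin n → ℝ}
    (h : IsSVD A U d V) (i : Fin n) (hi : B.rank ≤ i) : d i ≤ ‖A - B‖ := by
  have hker := LinearMap.finrank_range_add_finrank_ker (Matrix.toEuclideanLin B)
  rw [finrank_euclideanSpace_fin, finrank_range_toEuclideanLin] at hker
  obtain ⟨x, hxW, hx0, hx⟩ := exists_ne_zero_mem_of_card_lt
    (LinearMap.ker (Matrix.toEuclideanLin B)) Vᵀ (Finset.Ioi i) (by
      rw [Fin.card_Ioi]; have := i.2; omega)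
  have hxpos : 0 < ‖x‖ := norm_pos_iff.mpr hx0
  have h1 : d i * ‖x‖ ≤ ‖Matrix.toEuclideanLin A x‖ := by
    refine le_of_sq_le_sq ?_ (norm_nonneg _)
    rw [h.norm_toEuclideanLin_sq, mul_pow,
      ← norm_toEuclideanLin_of_mem_orthogonalGroup h.transpose_right_mem x,
      EuclideanSpace.real_norm_sq_eq, Finset.mul_sum]
    refine Finset.sum_le_sum fun j _ => ?_
    rw [mul_pow]
    rcases lt_or_ge i j with hj | hj
    · simp [hx j (Finset.mem_Ioi.mpr hj)]
    · exact mul_le_mul_of_nonneg_right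
        (pow_le_pow_left₀ (h.nonneg i) (h.antitone hj) 2) (sq_nonneg _)
  have h3 := norm_toEuclideanLin_le (A - B) x
  rw [map_sub, LinearMap.sub_apply, LinearMap.mem_ker.mp hxW, sub_zero] at h3
  exact le_of_mul_le_mul_right (h1.trans h3) hxpos

theorem singularValue_nonneg {p q : ℕ} (k : ℕ) (M : Matrix (Fin p) (Fin q) ℝ) :
    0 ≤ singularValue k M :=
  LinearMap.singularValues_nonneg _ _

/-- On the orthogonal complement of its kernel, which is the range of the transpose, a matrix of
rank `K` stretches every vector by at least its `K`-th singular value. -/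
theorem singularValue_mul_norm_le {p q : ℕ} (B : Matrix (Fin p) (Fin q) ℝ) {K : ℕ} (hK : 1 ≤ K)
    (hB : B.rank = K) (x : EuclideanSpace ℝ (Fin q))
    (hx : x ∈ LinearMap.range (Matrix.toEuclideanLin Bᵀ)) :
    singularValue K B * ‖x‖ ≤ ‖Matrix.toEuclideanLin B x‖ := by
  set T := Matrix.toEuclideanLin B with hT
  have hadj : Matrix.toEuclideanLin Bᵀ = LinearMap.adjoint T := by
    rw [← Matrix.conjTranspose_eq_transpose_of_trivial,
      Matrix.toEuclideanLin_conjTranspose_eq_adjoint]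
  have hS := T.isSymmetric_adjoint_comp_self
  have hq : Module.finrank ℝ (EuclideanSpace ℝ (Fin q)) = q := finrank_euclideanSpace_fin
  rw [hadj, ← LinearMap.range_adjoint_comp_self] at hx
  obtain ⟨y, rfl⟩ := hx
  set S := LinearMap.adjoint T ∘ₗ T with hSdef
  set b := hS.eigenvectorBasis hq with hb
  set ev := hS.eigenvalues hq with hev
  have hcoef : ∀ z i, inner ℝ (b i) (S z) = ev i * inner ℝ (b i) z := by
    intro z i
    rw [← hS (b i) z, hb, hS.apply_eigenvectorBasis hq i, inner_smul_left]
    simp [hev]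
  refine le_of_sq_le_sq ?_ (norm_nonneg _)
  have h1 : ‖T (S y)‖ ^ 2 = ∑ i, ev i * inner ℝ (b i) (S y) ^ 2 := by
    rw [← real_inner_self_eq_norm_sq, ← LinearMap.adjoint_inner_right,
      ← LinearMap.comp_apply (LinearMap.adjoint T), ← b.sum_inner_mul_inner]
    refine Finset.sum_congr rfl fun i _ => ?_
    rw [← hSdef, hcoef (S y), real_inner_comm]
    ring
  rw [h1, mul_pow, ← b.sum_sq_inner_right, Finset.mul_sum]
  refine Finset.sum_le_sum fun i _ => ?_
  by_cases h0 : inner ℝ (b i) (S y) = 0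
  · simp [h0]
  refine mul_le_mul_of_nonneg_right ?_ (sq_nonneg _)
  have hev0 : ev i ≠ 0 := fun h => h0 (by rw [hcoef, h, zero_mul])
  rw [hev, ← T.sq_singularValues_fin hq i] at hev0 ⊢
  have hpos : T.singularValues i ≠ 0 := fun h => hev0 (by rw [h]; simp)
  have hlt : (i : ℕ) < K := by
    rw [← T.singularValues_pos_iff_ne_zero, T.singularValues_pos_iff_lt_finrank_range,
      finrank_range_toEuclideanLin, hB] at hpos
    exact hpos
  exact pow_le_pow_left₀ (T.singularValues_nonneg _) (T.singularValues_antitone (by omega)) 2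

end LinearAlgebra

section Deterministic

open scoped Matrix.Norms.L2Operator

/-! ### Truncated singular value decompositions and their pseudoinverses -/

theorem IsSVD.left_mul {n : ℕ} {M U V : Matrix (Fin n) (Fin n) ℝ} {d : Fin n → ℝ}
    (h : IsSVD M U d V) : Uᵀ * U = 1 :=
  (Matrix.mem_orthogonalGroup_iff' _ _).mp h.left_mem

theorem IsSVD.right_mul {n : ℕ} {M U V : Matrix (Fin n) (Fin n) ℝ} {d : Fin n → ℝ}
    (h : IsSVD M U d V) : Vᵀ * V = 1 :=
  (Matrix.mem_orthogonalGroup_iff' _ _).mp h.right_mem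

theorem isMoorePenrose_mul_diagonal_mul {n : ℕ} {U V : Matrix (Fin n) (Fin n) ℝ}
    (hU : Uᵀ * U = 1) (hV : Vᵀ * V = 1) (a : Fin n → ℝ) :
    IsMoorePenrose (U * Matrix.diagonal a * Vᵀ)
      (V * Matrix.diagonal (fun i => (a i)⁻¹) * Uᵀ) := by
  have key : ∀ (U V W : Matrix (Fin n) (Fin n) ℝ), Vᵀ * V = 1 → ∀ (a b : Fin n → ℝ),
      (U * Matrix.diagonal a * Vᵀ) * (V * Matrix.diagonal b * Wᵀ)
        = U * Matrix.diagonal (fun i => a i * b i) * Wᵀ := by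
    intro U V W hV a b
    calc _ = U * Matrix.diagonal a * (Vᵀ * V) * Matrix.diagonal b * Wᵀ := by
          simp only [Matrix.mul_assoc]
      _ = _ := by rw [hV, Matrix.mul_one, Matrix.mul_assoc U, Matrix.diagonal_mul_diagonal]
  have tr : ∀ (U : Matrix (Fin n) (Fin n) ℝ) (a : Fin n → ℝ),
      (U * Matrix.diagonal a * Uᵀ)ᵀ = U * Matrix.diagonal a * Uᵀ := by
    intro U a
    simp [Matrix.transpose_mul, Matrix.mul_assoc]
  refine ⟨?_, ?_, ?_, ?_⟩
  · rw [key _ _ _ hV, key _ _ _ hU]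
    congr 3
    funext i
    by_cases h : a i = 0 <;> simp [h]
  · rw [key _ _ _ hU, key _ _ _ hV]
    congr 3
    funext i
    by_cases h : a i = 0 <;> simp [h]
  · rw [key _ _ _ hV, tr]
  · rw [key _ _ _ hU, tr]

theorem moorePenrose_mul_diagonal_mul {n : ℕ} {U V : Matrix (Fin n) (Fin n) ℝ}
    (hU : Uᵀ * U = 1) (hV : Vᵀ * V = 1) (a : Fin n → ℝ) :
    moorePenrose (U * Matrix.diagonal a * Vᵀ) = V * Matrix.diagonal (fun i => (a i)⁻¹) * Uᵀ :=
  (isMoorePenrose_moorePenrose _).unique (isMoorePenrose_mul_diagonal_mul hU hV a)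

theorem opNorm_mul_diagonal_mul_le {n : ℕ} {U V : Matrix (Fin n) (Fin n) ℝ}
    (hU : U ∈ Matrix.orthogonalGroup (Fin n) ℝ) (hV : V ∈ Matrix.orthogonalGroup (Fin n) ℝ)
    (a : Fin n → ℝ) {c : ℝ} (hc : 0 ≤ c) (ha : ∀ i, |a i| ≤ c) :
    ‖U * Matrix.diagonal a * Vᵀ‖ ≤ c := by
  have h1 := opNorm_le_one_of_mem_orthogonalGroup hU
  have h2 := opNorm_le_one_of_mem_orthogonalGroup hV
  rw [← opNorm_transpose] at h2
  calc ‖U * Matrix.diagonal a * Vᵀ‖ ≤ ‖U‖ * ‖Matrix.diagonal a‖ * ‖Vᵀ‖ :=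
        (Matrix.l2_opNorm_mul _ _).trans
          (mul_le_mul_of_nonneg_right (Matrix.l2_opNorm_mul _ _) (norm_nonneg _))
    _ ≤ 1 * c * 1 := by
        gcongr
        exact opNorm_diagonal_le a hc ha
    _ = c := by ring

theorem IsSVD.norm_moorePenrose_truncatedSVD_le {n : ℕ} {A U V : Matrix (Fin n) (Fin n) ℝ}
    {d : Fin n → ℝ} (h : IsSVD A U d V) (K : ℕ) {c : ℝ} (hc : 0 < c)
    (hd : ∀ i : Fin n, (i : ℕ) < K → c ≤ d i) :
    ‖moorePenrose (truncatedSVD K U d V)‖ ≤ 1 / c := by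
  rw [truncatedSVD, moorePenrose_mul_diagonal_mul h.left_mul h.right_mul]
  refine opNorm_mul_diagonal_mul_le h.right_mem h.left_mem _ (by positivity) fun i => ?_
  split_ifs with hi
  · rw [abs_of_nonneg (inv_nonneg.mpr (h.nonneg i)), ← one_div]
    exact one_div_le_one_div_of_le hc (hd i hi)
  · simp only [inv_zero, abs_zero]; positivity

/-- Truncation can only decrease the norm of the pseudoinverse. -/
theorem IsSVD.norm_moorePenrose_truncatedSVD_le_norm_moorePenrose {n : ℕ}
    {A U V : Matrix (Fin n) (Fin n) ℝ} {d : Fin n → ℝ} (h : IsSVD A U d V) (K : ℕ) :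
    ‖moorePenrose (truncatedSVD K U d V)‖ ≤ ‖moorePenrose A‖ := by
  have hV := h.right_mul
  have hfac : moorePenrose (truncatedSVD K U d V)
      = (V * Matrix.diagonal (fun i : Fin n => if (i : ℕ) < K then (1 : ℝ) else 0) * Vᵀ)
        * moorePenrose A := by
    rw [truncatedSVD, moorePenrose_mul_diagonal_mul h.left_mul h.right_mul, h.eq_mul,
      moorePenrose_mul_diagonal_mul h.left_mul h.right_mul]
    calc _ = V * (Matrix.diagonal (fun i : Fin n => if (i : ℕ) < K then (1 : ℝ) else 0)
          * Matrix.diagonal (fun i => (d i)⁻¹)) * Uᵀ := by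
          rw [Matrix.diagonal_mul_diagonal]
          congr 3
          funext i
          split_ifs <;> simp
      _ = V * Matrix.diagonal (fun i : Fin n => if (i : ℕ) < K then (1 : ℝ) else 0) * (Vᵀ * V)
          * Matrix.diagonal (fun i => (d i)⁻¹) * Uᵀ := by
          rw [hV, Matrix.mul_one, ← Matrix.mul_assoc]
      _ = _ := by simp only [Matrix.mul_assoc]
  rw [hfac]
  refine (Matrix.l2_opNorm_mul _ _).trans (mul_le_of_le_one_left (norm_nonneg _) ?_)
  refine opNorm_mul_diagonal_mul_le h.right_mem h.right_mem _ zero_le_one fun i => ?_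
  split_ifs <;> simp

theorem IsSVD.norm_sub_truncatedSVD_le {n : ℕ} {A U V : Matrix (Fin n) (Fin n) ℝ}
    {d : Fin n → ℝ} (h : IsSVD A U d V) (K : ℕ) {c : ℝ} (hc : 0 ≤ c)
    (hd : ∀ i : Fin n, K ≤ i → d i ≤ c) : ‖A - truncatedSVD K U d V‖ ≤ c := by
  have : A - truncatedSVD K U d V
      = U * Matrix.diagonal (fun i : Fin n => if (i : ℕ) < K then 0 else d i) * Vᵀ := by
    rw [h.eq_mul, truncatedSVD, ← Matrix.sub_mul, ← Matrix.mul_sub, Matrix.diagonal_sub]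
    congr 3
    funext i
    split_ifs <;> simp
  rw [this]
  refine opNorm_mul_diagonal_mul_le h.left_mem h.right_mem _ hc fun i => ?_
  split_ifs with hi
  · simpa using hc
  · rw [abs_of_nonneg (h.nonneg i)]
    exact hd i (not_lt.mp hi)

theorem rank_moorePenrose_truncatedSVD_le {n : ℕ} {A U V : Matrix (Fin n) (Fin n) ℝ}
    {d : Fin n → ℝ} (h : IsSVD A U d V) (K : ℕ) :
    (moorePenrose (truncatedSVD K U d V)).rank ≤ K := by
  rw [truncatedSVD, moorePenrose_mul_diagonal_mul h.left_mul h.right_mul]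
  refine (Matrix.rank_mul_le_left _ _).trans ((Matrix.rank_mul_le_right _ _).trans ?_)
  rw [Matrix.rank_diagonal, Fintype.card_subtype]
  calc _ ≤ (Finset.univ.filter fun i : Fin n => (i : ℕ) < K).card := by
        refine Finset.card_le_card fun i => ?_
        simp only [Finset.mem_filter, Finset.mem_univ, true_and]
        intro hi
        by_contra hK
        simp [hK] at hi
    _ ≤ (Finset.range K).card :=
        Finset.card_le_card_of_injOn (fun i => (i : ℕ)) (fun i hi => by simpa using hi)
          (fun i _ j _ hij => Fin.ext hij)
    _ = K := Finset.card_range K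

/-! ### Completing a low-rank matrix from two of its blocks -/

/-- If the leading block has the full rank of `P`, the columns of `P` through the leading block
span its column space. -/
theorem exists_mul_eq_of_rank_eq {n m : ℕ} {P : Matrix (Fin (n + m)) (Fin (n + m)) ℝ}
    (h : (block₁₁ P).rank = P.rank) :
    ∃ Z : Matrix (Fin n) (Fin m) ℝ,
      P.submatrix id (Fin.castAdd m) * Z = P.submatrix id (Fin.natAdd n) := by
  set C := P.submatrix id (Fin.castAdd m) with hC
  have hle : LinearMap.range C.mulVecLin ≤ LinearMap.range P.mulVecLin := by
    rw [Matrix.range_mulVecLin, Matrix.range_mulVecLin]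
    refine Submodule.span_mono ?_
    rintro _ ⟨j, rfl⟩
    exact ⟨Fin.castAdd m j, rfl⟩
  have hrank : P.rank ≤ C.rank := by
    rw [← h]
    exact Matrix.rank_submatrix_le (A := C) (Fin.castAdd m) (Equiv.refl _)
  have heq : LinearMap.range C.mulVecLin = LinearMap.range P.mulVecLin :=
    Submodule.eq_of_le_of_finrank_le hle hrank
  have hcol : ∀ j : Fin m, ∃ z : Fin n → ℝ, C *ᵥ z = P.col (Fin.natAdd n j) := by
    intro j
    have : P.col (Fin.natAdd n j) ∈ LinearMap.range C.mulVecLin := by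
      rw [heq, Matrix.range_mulVecLin]
      exact Submodule.subset_span ⟨_, rfl⟩
    exact this
  choose z hz using hcol
  refine ⟨Matrix.of fun i j => z j i, ?_⟩
  ext i j
  have := congrFun (hz j) i
  simpa [Matrix.mulVec, dotProduct, Matrix.mul_apply] using this

/-- The unobserved block of a symmetric matrix whose leading block has full rank is a quadratic
expression in a bounded matrix `Z`, which solves `P₁₁ Z = P₁₂`. -/
theorem exists_block_factorization {n m K : ℕ} {P : Matrix (Fin (n + m)) (Fin (n + m)) ℝ}
    (hP : P.IsSymm) (hK : 1 ≤ K) (h₁₁ : (block₁₁ P).rank = K) (h : P.rank = K) :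
    ∃ Z : Matrix (Fin n) (Fin m) ℝ, block₁₁ P * Z = block₁₂ P ∧
      Zᵀ * block₁₁ P * Z = block₂₂ P ∧ singularValue K (block₁₁ P) * ‖Z‖ ≤ ‖block₁₂ P‖ := by
  obtain ⟨Z₀, hZ₀⟩ := exists_mul_eq_of_rank_eq (h₁₁.trans h.symm)
  have hsymm : (block₁₁ P)ᵀ = block₁₁ P := by
    ext i j
    exact hP.apply _ _
  have h12 : block₁₁ P * Z₀ = block₁₂ P := by
    ext i j
    exact congrFun (congrFun hZ₀ (Fin.castAdd m i)) j
  have h22 : (block₁₂ P)ᵀ * Z₀ = block₂₂ P := by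
    have : (block₁₂ P)ᵀ = P.submatrix (Fin.natAdd n) (Fin.castAdd m) := by
      ext i j
      exact hP.apply _ _
    rw [this]
    ext i j
    exact congrFun (congrFun hZ₀ (Fin.natAdd n i)) j
  have hX := isMoorePenrose_moorePenrose (block₁₁ P)
  set X := moorePenrose (block₁₁ P)
  have hZ : block₁₁ P * (X * block₁₂ P) = block₁₂ P := by
    rw [← h12, ← Matrix.mul_assoc, ← Matrix.mul_assoc, hX.mul_mul_self]
  refine ⟨X * block₁₂ P, hZ, ?_, ?_⟩
  · calc (X * block₁₂ P)ᵀ * block₁₁ P * (X * block₁₂ P)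
        = (X * block₁₂ P)ᵀ * (block₁₁ P)ᵀ * Z₀ := by
          rw [Matrix.mul_assoc, hZ, ← h12, hsymm, Matrix.mul_assoc]
      _ = (block₁₁ P * (X * block₁₂ P))ᵀ * Z₀ := by rw [← Matrix.transpose_mul]
      _ = block₂₂ P := by rw [hZ, h22]
  · rcases (singularValue_nonneg K (block₁₁ P)).eq_or_lt with hs | hs
    · rw [← hs, zero_mul]; exact norm_nonneg _
    rw [mul_comm, ← le_div_iff₀ hs]
    refine opNorm_le_of_forall _ (by positivity) fun x => ?_
    rw [div_mul_eq_mul_div, le_div_iff₀ hs, mul_comm]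
    have hmem : Matrix.toEuclideanLin (X * block₁₂ P) x
        ∈ LinearMap.range (Matrix.toEuclideanLin (block₁₁ P)ᵀ) := by
      refine ⟨Matrix.toEuclideanLin (Xᵀ * (X * block₁₂ P)) x, ?_⟩
      rw [← toEuclideanLin_mul]
      congr 2
      rw [← Matrix.mul_assoc, ← Matrix.mul_assoc, ← Matrix.transpose_mul, hX.symm_mul,
        hX.self_mul_mul]
    refine (singularValue_mul_norm_le _ hK h₁₁ _ hmem).trans ?_
    rw [← toEuclideanLin_mul, hZ]
    exact norm_toEuclideanLin_le _ _

/-! ### The deterministic error bound -/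

/-- Expanding `R - P₂₂` around `P₁₁ = M + F` and `A₁₂ = P₁₁ Z + E`, where `M` is the truncation of
`A₁₁` and `X` its pseudoinverse, gives an error controlled by `‖F‖`, `‖X‖`, `‖Z‖` and `‖E‖`. -/
theorem norm_quadratic_sub_le {n m : ℕ} {Q M X : Matrix (Fin n) (Fin n) ℝ}
    {Z E : Matrix (Fin n) (Fin m) ℝ} (hQ : Qᵀ = Q) (hX : IsMoorePenrose M X)
    {f x z e : ℝ} (hf : ‖Q - M‖ ≤ f) (hx : ‖X‖ ≤ x) (hz : ‖Z‖ ≤ z) (he : ‖E‖ ≤ e) :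
    ‖(Q * Z + E)ᵀ * X * (Q * Z + E) - Zᵀ * Q * Z‖
      ≤ z ^ 2 * (3 * f + f ^ 2 * x) + 2 * z * e * (1 + x * f) + e ^ 2 * x := by
  have hf0 : 0 ≤ f := (norm_nonneg _).trans hf
  have hx0 : 0 ≤ x := (norm_nonneg _).trans hx
  have hz0 : 0 ≤ z := (norm_nonneg _).trans hz
  have he0 : 0 ≤ e := (norm_nonneg _).trans he
  set F := Q - M with hF
  have hQM : Q = M + F := by simp [hF]
  have hXM : ‖X * M‖ ≤ 1 := by
    refine opNorm_le_one_of_symm_of_idem hX.symm_mul ?_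
    rw [← Matrix.mul_assoc, hX.self_mul_mul]
  have hMX : ‖M * X‖ ≤ 1 := by
    refine opNorm_le_one_of_symm_of_idem hX.mul_symm ?_
    rw [← Matrix.mul_assoc, hX.mul_mul_self]
  have hmul : ∀ {a b c : ℕ} (S : Matrix (Fin a) (Fin b) ℝ) (T : Matrix (Fin b) (Fin c) ℝ)
      {s t : ℝ}, ‖S‖ ≤ s → ‖T‖ ≤ t → ‖S * T‖ ≤ s * t := by
    intro a b c S T s t hs ht
    exact (Matrix.l2_opNorm_mul S T).trans
      (mul_le_mul hs ht (norm_nonneg _) ((norm_nonneg _).trans hs))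
  have hG : ‖Q * X * Q - Q‖ ≤ 3 * f + f ^ 2 * x := by
    have : Q * X * Q - Q = -F + F * (X * M) + (M * X) * F + F * X * F := by
      rw [hQM]
      have h1 := hX.mul_mul_self
      calc (M + F) * X * (M + F) - (M + F)
          = M * X * M + F * (X * M) + M * X * F + F * X * F - M - F := by
            simp only [Matrix.add_mul, Matrix.mul_add, Matrix.mul_assoc]; abel
        _ = _ := by rw [h1]; abel
    rw [this]
    have h1 := hmul F (X * M) hf hXM
    have h2 := hmul (M * X) F hMX hf
    have h3 := hmul (F * X) F (hmul F X hf hx) hf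
    have h4 : ‖-F‖ ≤ f := by rwa [norm_neg]
    have := (norm_add_le _ _).trans (add_le_add ((norm_add_le _ _).trans
      (add_le_add ((norm_add_le _ _).trans (add_le_add h4 h1)) h2)) h3)
    linarith
  have hXQ : ‖X * Q‖ ≤ 1 + x * f := by
    rw [hQM, Matrix.mul_add]
    exact (norm_add_le _ _).trans (add_le_add hXM (hmul X F hx hf))
  have hQX : ‖Q * X‖ ≤ 1 + x * f := by
    rw [hQM, Matrix.add_mul, mul_comm x f]
    exact (norm_add_le _ _).trans (add_le_add hMX (hmul F X hf hx))
  have hzt : ‖Zᵀ‖ ≤ z := by rwa [opNorm_transpose]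
  have het : ‖Eᵀ‖ ≤ e := by rwa [opNorm_transpose]
  have hdec : (Q * Z + E)ᵀ * X * (Q * Z + E) - Zᵀ * Q * Z
      = Zᵀ * (Q * X * Q - Q) * Z + Eᵀ * (X * Q) * Z + Zᵀ * (Q * X) * E + Eᵀ * X * E := by
    rw [Matrix.transpose_add, Matrix.transpose_mul, hQ]
    simp only [Matrix.add_mul, Matrix.mul_add, Matrix.mul_assoc, Matrix.mul_sub, Matrix.sub_mul]
    abel
  rw [hdec]
  have h1 := hmul _ Z (hmul Zᵀ _ hzt hG) hz
  have h2 := hmul _ Z (hmul Eᵀ _ het hXQ) hz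
  have h3 := hmul _ E (hmul Zᵀ _ hzt hQX) he
  have h4 := hmul _ E (hmul Eᵀ _ het hx) he
  have := (norm_add_le _ _).trans (add_le_add ((norm_add_le _ _).trans
      (add_le_add ((norm_add_le _ _).trans (add_le_add h1 h2)) h3)) h4)
  linarith

end Deterministic

/-! ### Closed walks and traces of powers -/

section Walks

/-- The unordered pair of vertices joined by the `t`-th step of the walk `w`. -/
def walkStep {V : Type*} {l : ℕ} (w : Fin (l + 1) → V) (t : Fin l) : Sym2 V :=
  s(w t.castSucc, w t.succ)

/-- A closed walk without loops which traverses no edge exactly once. -/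
def IsRecurrentWalk {V : Type*} {l : ℕ} (w : Fin (l + 1) → V) : Prop :=
  w 0 = w (Fin.last l) ∧ (∀ t : Fin l, w t.castSucc ≠ w t.succ) ∧
    ∀ t : Fin l, ∃ t', t' ≠ t ∧ walkStep w t' = walkStep w t

theorem matrix_pow_apply {V R : Type*} [Fintype V] [DecidableEq V] [CommRing R] (X : Matrix V V R)
    (l : ℕ) (i j : V) :
    (X ^ l) i j = ∑ w : Fin (l + 1) → V, if w 0 = i ∧ w (Fin.last l) = j then
      ∏ t : Fin l, X (w t.castSucc) (w t.succ) else 0 := by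
  induction l generalizing i with
  | zero =>
    rw [← (Equiv.funUnique (Fin 1) V).symm.sum_comp]
    simp [Matrix.one_apply, ite_and, Equiv.funUnique, uniqueElim]
  | succ l ih =>
    rw [pow_succ', Matrix.mul_apply, ← (Fin.consEquiv fun _ : Fin (l + 2) => V).sum_comp,
      Fintype.sum_prod_type]
    simp only [ih, Finset.mul_sum, Fin.consEquiv_apply]
    symm
    rw [Finset.sum_eq_single i (fun a _ ha => by simp [ha]) (by simp)]
    symm
    rw [Finset.sum_comm]
    refine Finset.sum_congr rfl fun w _ => ?_
    rw [Finset.sum_eq_single (w 0) (fun a _ ha => by simp [ha.symm]) (by simp)]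
    by_cases h : w (Fin.last l) = j
    · rw [if_pos ⟨rfl, h⟩, if_pos ⟨by simp, by rw [← Fin.succ_last, Fin.cons_succ, h]⟩,
        Fin.prod_univ_succ]
      simp
    · rw [if_neg (fun h' => h h'.2), mul_zero,
        if_neg (fun h' => h (by rw [← h'.2, ← Fin.succ_last, Fin.cons_succ]))]

theorem matrix_trace_pow {V R : Type*} [Fintype V] [DecidableEq V] [CommRing R] (X : Matrix V V R)
    (l : ℕ) :
    (X ^ l).trace = ∑ w : Fin (l + 1) → V, if w 0 = w (Fin.last l) then
      ∏ t : Fin l, X (w t.castSucc) (w t.succ) else 0 := by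
  simp only [Matrix.trace, Matrix.diag_apply, matrix_pow_apply]
  rw [Finset.sum_comm]
  refine Finset.sum_congr rfl fun w _ => ?_
  rw [Finset.sum_eq_single (w 0) (fun a _ ha => by simp [ha.symm]) (by simp)]
  by_cases h : w 0 = w (Fin.last l)
  · simp [h]
  · rw [if_neg h, if_neg (fun h' => h h'.2.symm)]

/-- A walk visits at most one vertex more than it has distinct edges. -/
theorem card_image_le_card_image_walkStep {V : Type*} [DecidableEq V] {l : ℕ}
    (w : Fin (l + 1) → V) :
    (Finset.univ.image w).card ≤ (Finset.univ.image (walkStep w)).card + 1 := by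
  induction l with
  | zero =>
    refine (Finset.card_image_le).trans ?_
    simp
  | succ l ih =>
    have h1 : Finset.univ.image w
        = insert (w (Fin.last _)) (Finset.univ.image fun i : Fin (l + 1) => w i.castSucc) := by
      ext v
      simp only [Finset.mem_image, Finset.mem_univ, true_and, Finset.mem_insert]
      constructor
      · rintro ⟨i, rfl⟩
        induction i using Fin.lastCases with
        | last => exact Or.inl rfl
        | cast i => exact Or.inr ⟨i, rfl⟩
      · rintro (rfl | ⟨i, rfl⟩)
        exacts [⟨_, rfl⟩, ⟨_, rfl⟩]
    have h2 : Finset.univ.image (walkStep w) = insert (walkStep w (Fin.last _))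
        (Finset.univ.image (walkStep fun i : Fin (l + 1) => w i.castSucc)) := by
      ext v
      simp only [Finset.mem_image, Finset.mem_univ, true_and, Finset.mem_insert]
      constructor
      · rintro ⟨i, rfl⟩
        induction i using Fin.lastCases with
        | last => exact Or.inl rfl
        | cast i => exact Or.inr ⟨i, rfl⟩
      · rintro (rfl | ⟨i, rfl⟩)
        exacts [⟨_, rfl⟩, ⟨i.castSucc, rfl⟩]
    have h3 := ih fun i => w i.castSucc
    rw [h1, h2]
    by_cases hmem : w (Fin.last _) ∈ Finset.univ.image fun i : Fin (l + 1) => w i.castSucc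
    · rw [Finset.insert_eq_of_mem hmem]
      exact h3.trans (Nat.add_le_add_right (Finset.card_le_card (Finset.subset_insert _ _)) 1)
    · rw [Finset.card_insert_of_notMem hmem, Finset.card_insert_of_notMem]
      · exact Nat.add_le_add_right h3 1
      · intro h
        obtain ⟨t, -, ht⟩ := Finset.mem_image.mp h
        refine hmem ?_
        have h4 : w (Fin.last _) ∈ walkStep (fun i : Fin (l + 1) => w i.castSucc) t := by
          rw [ht]
          exact Sym2.mem_iff.mpr (Or.inr rfl)
        rcases Sym2.mem_iff.mp h4 with h5 | h5
        · exact Finset.mem_image.mpr ⟨_, Finset.mem_univ _, h5.symm⟩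
        · exact Finset.mem_image.mpr ⟨_, Finset.mem_univ _, h5.symm⟩

theorem IsRecurrentWalk.two_mul_card_le {V : Type*} [DecidableEq V] {l : ℕ} {w : Fin (l + 1) → V}
    (h : IsRecurrentWalk w) : 2 * (Finset.univ.image (walkStep w)).card ≤ l := by
  have := Finset.mul_card_image_le_card (f := walkStep w) Finset.univ 2 (by
    intro e he
    obtain ⟨t, -, rfl⟩ := Finset.mem_image.mp he
    obtain ⟨t', hne, ht'⟩ := h.2.2 t
    exact Finset.one_lt_card.mpr ⟨t', by simp [ht'], t, by simp, hne⟩)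
  simpa using this

theorem card_image_le_card_image_of_forall {α β γ : Type*} [DecidableEq β] [DecidableEq γ]
    (s : Finset α) {f : α → β} {g : α → γ} (h : ∀ a b, g a = g b → f a = f b) :
    (s.image f).card ≤ (s.image g).card := by
  rcases isEmpty_or_nonempty α with hα | hα
  · simp [Finset.eq_empty_of_isEmpty s]
  choose! u hu using fun a (ha : a ∈ s.image f) => Finset.mem_image.mp ha
  refine Finset.card_le_card_of_injOn (fun a => g (u a))
    (fun a ha => Finset.mem_image_of_mem _ (hu a ha).1) fun a ha b hb hab => ?_
  rw [← (hu a ha).2, ← (hu b hb).2]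
  exact h _ _ hab

/-! ### Counting walks by their pattern of coincidences -/

/-- The pattern of coincidences of a walk: which pairs of times it spends at the same vertex. -/
def walkPattern {V : Type*} {l : ℕ} (w : Fin (l + 1) → V) : Fin (l + 1) → Fin (l + 1) → Prop :=
  fun i j => w i = w j

theorem walkPattern_eq_iff {V V' : Type*} {l : ℕ} {w : Fin (l + 1) → V} {w' : Fin (l + 1) → V'} :
    walkPattern w = walkPattern w' ↔ ∀ i j, w i = w j ↔ w' i = w' j := by
  simp [walkPattern, funext_iff]

theorem IsRecurrentWalk.congr {V V' : Type*} {l : ℕ} {w : Fin (l + 1) → V} {w' : Fin (l + 1) → V'}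
    (h : walkPattern w = walkPattern w') (hw : IsRecurrentWalk w) : IsRecurrentWalk w' := by
  rw [walkPattern_eq_iff] at h
  simpa only [IsRecurrentWalk, walkStep, Sym2.eq_iff, ne_eq, h] using hw

open Classical in
/-- The walks with a given pattern correspond to the embeddings of the visited vertices. -/
theorem card_filter_walkPattern_eq {V : Type*} [DecidableEq V] {l n : ℕ} (w₀ : Fin (l + 1) → V) :
    (Finset.univ.filter fun w : Fin (l + 1) → Fin n => walkPattern w = walkPattern w₀).card
      = n.descFactorial (Finset.univ.image w₀).card := by
  let e : {w : Fin (l + 1) → Fin n // walkPattern w = walkPattern w₀}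
      ≃ ((Finset.univ.image w₀ : Finset V) ↪ Fin n) :=
    { toFun := fun w =>
        ⟨fun a => w.1 (Finset.mem_image.mp a.2).choose, fun a b hab => by
          have := (walkPattern_eq_iff.mp w.2 _ _).mp hab
          rw [(Finset.mem_image.mp a.2).choose_spec.2,
            (Finset.mem_image.mp b.2).choose_spec.2] at this
          exact Subtype.ext this⟩
      invFun := fun f => ⟨fun i => f ⟨w₀ i, Finset.mem_image_of_mem _ (Finset.mem_univ _)⟩, by
        rw [walkPattern_eq_iff]
        intro i j
        rw [f.injective.eq_iff, Subtype.mk.injEq]⟩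
      left_inv := fun w => by
        ext i : 2
        refine (walkPattern_eq_iff.mp w.2 _ _).mpr ?_
        exact (Finset.mem_image.mp
          (Finset.mem_image_of_mem w₀ (Finset.mem_univ i))).choose_spec.2
      right_inv := fun f => by
        ext a : 1
        change f _ = f a
        congr 1
        exact Subtype.ext (Finset.mem_image.mp a.2).choose_spec.2 }
  rw [← Fintype.card_subtype, Fintype.card_congr e, Fintype.card_embedding_eq, Fintype.card_fin,
    Fintype.card_coe]

theorem card_image_le_of_walkPattern_eq {V V' : Type*} [DecidableEq V] [DecidableEq V'] {l : ℕ}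
    {w : Fin (l + 1) → V} {w' : Fin (l + 1) → V'} (h : walkPattern w = walkPattern w') :
    (Finset.univ.image w).card ≤ (Finset.univ.image w').card := by
  rw [walkPattern_eq_iff] at h
  exact card_image_le_card_image_of_forall _ fun i j => (h i j).mpr

open Classical in
/-- Comparison of dimensions: the weighted number of recurrent walks on `n` vertices, with weight
`p` for each vertex after the first, is at most `n` times the number of recurrent walks on about
`n p` vertices. Both counts are sums over patterns, and a pattern with `v` vertices is realized by
at most `n ^ v` walks on `n` vertices, but by at least `(r + 1 - v) ^ v` walks on `r` vertices. -/
theorem sum_recurrentWalk_le {n r k : ℕ} {p : ℝ} (hp : 0 ≤ p) (hr : n * p + k ≤ r) (hkr : k < r) :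
    ∑ w : Fin (2 * k + 1) → Fin n with IsRecurrentWalk w, p ^ ((Finset.univ.image w).card - 1)
      ≤ n * (Finset.univ.filter fun w : Fin (2 * k + 1) → Fin r => IsRecurrentWalk w).card := by
  rw [← Finset.sum_fiberwise _ (fun w : Fin (2 * k + 1) → Fin n => walkPattern w),
    Finset.card_eq_sum_ones, ← Finset.sum_fiberwise _
      (fun w : Fin (2 * k + 1) → Fin r => walkPattern w), Nat.cast_sum, Finset.mul_sum]
  refine Finset.sum_le_sum fun κ _ => ?_
  by_cases hex : ∃ w : Fin (2 * k + 1) → Fin n, IsRecurrentWalk w ∧ walkPattern w = κ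
  swap
  · rw [Finset.sum_eq_zero]
    · positivity
    · intro w hw
      simp only [Finset.mem_filter, Finset.mem_univ, true_and] at hw
      exact absurd ⟨w, hw⟩ hex
  obtain ⟨w₀, hw₀, rfl⟩ := hex
  set v := (Finset.univ.image w₀).card with hv
  have hv1 : 1 ≤ v := Finset.card_pos.mpr ⟨w₀ 0, Finset.mem_image_of_mem _ (Finset.mem_univ _)⟩
  have hvk : v ≤ k + 1 := by
    have h1 := card_image_le_card_image_walkStep w₀
    have h2 := hw₀.two_mul_card_le
    omega
  have hfil : ∀ q : ℕ, (Finset.univ.filter fun w : Fin (2 * k + 1) → Fin q =>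
      IsRecurrentWalk w).filter (fun w => walkPattern w = walkPattern w₀)
      = Finset.univ.filter fun w : Fin (2 * k + 1) → Fin q => walkPattern w = walkPattern w₀ := by
    intro q
    ext w
    simp only [Finset.mem_filter, Finset.mem_univ, true_and, and_iff_right_iff_imp]
    exact fun h => hw₀.congr h.symm
  rw [hfil, hfil, ← Finset.card_eq_sum_ones, card_filter_walkPattern_eq]
  have hsum : ∀ w ∈ Finset.univ.filter (fun w : Fin (2 * k + 1) → Fin n =>
      walkPattern w = walkPattern w₀), p ^ ((Finset.univ.image w).card - 1) = p ^ (v - 1) := by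
    intro w hw
    have hw' := (Finset.mem_filter.mp hw).2
    rw [hv, le_antisymm (card_image_le_of_walkPattern_eq hw')
      (card_image_le_of_walkPattern_eq hw'.symm)]
  rw [Finset.sum_congr rfl hsum, Finset.sum_const, card_filter_walkPattern_eq, ← hv, nsmul_eq_mul]
  have h1 : ((r + 1 - v : ℕ) : ℝ) ^ v ≤ (r.descFactorial v : ℝ) := by
    exact_mod_cast Nat.pow_sub_le_descFactorial r v
  have h2 : (n.descFactorial v : ℝ) ≤ (n : ℝ) ^ v := by
    exact_mod_cast Nat.descFactorial_le_pow n v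
  have h3 : n * p ≤ ((r + 1 - v : ℕ) : ℝ) := by
    have : ((r - k : ℕ) : ℝ) ≤ ((r + 1 - v : ℕ) : ℝ) := by exact_mod_cast by omega
    rw [Nat.cast_sub hkr.le] at this
    linarith
  have h4 : (1 : ℝ) ≤ ((r + 1 - v : ℕ) : ℝ) := by exact_mod_cast by omega
  obtain ⟨u, hu⟩ : ∃ u, v = u + 1 := ⟨v - 1, by omega⟩
  calc (n.descFactorial v : ℝ) * p ^ (v - 1) ≤ (n : ℝ) ^ v * p ^ (v - 1) := by gcongr
    _ = n * (n * p) ^ (v - 1) := by rw [hu, Nat.add_sub_cancel, mul_pow]; ring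
    _ ≤ n * ((r + 1 - v : ℕ) : ℝ) ^ (v - 1) := by gcongr
    _ ≤ n * ((r + 1 - v : ℕ) : ℝ) ^ v := by gcongr; exact v.sub_le 1
    _ ≤ n * (r.descFactorial v : ℝ) := by gcongr

end Walks

/-! ### Symmetric matrices with prescribed entries above the diagonal -/

section Edges

/-- The positions above the diagonal of an `n × n` matrix. -/
abbrev EdgeIndex (n : ℕ) : Type := {e : Fin n × Fin n // e.1 < e.2}

/-- The symmetric matrix with zero diagonal and the entries `ξ` above the diagonal. -/
def symmMatrix {n : ℕ} (ξ : EdgeIndex n → ℝ) : Matrix (Fin n) (Fin n) ℝ := fun i j =>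
  if h : i < j then ξ ⟨(i, j), h⟩ else if h : j < i then ξ ⟨(j, i), h⟩ else 0

/-- The position above the diagonal which corresponds to the pair of distinct indices `i`, `j`. -/
def edgeOf {n : ℕ} (i j : Fin n) (h : i ≠ j) : EdgeIndex n :=
  if h' : i < j then ⟨(i, j), h'⟩ else ⟨(j, i), lt_of_le_of_ne (not_lt.mp h') h.symm⟩

theorem symmMatrix_apply_of_ne {n : ℕ} (ξ : EdgeIndex n → ℝ) {i j : Fin n} (h : i ≠ j) :
    symmMatrix ξ i j = ξ (edgeOf i j h) := by
  unfold symmMatrix edgeOf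
  split_ifs with h1 h2
  · rfl
  · rfl
  · omega

theorem symmMatrix_apply_self {n : ℕ} (ξ : EdgeIndex n → ℝ) (i : Fin n) :
    symmMatrix ξ i i = 0 := by
  simp [symmMatrix]

theorem symmMatrix_transpose {n : ℕ} (ξ : EdgeIndex n → ℝ) :
    (symmMatrix ξ)ᵀ = symmMatrix ξ := by
  ext i j
  simp only [Matrix.transpose_apply, symmMatrix]
  split_ifs with h1 h2
  · omega
  all_goals rfl

theorem edgeOf_eq_iff {n : ℕ} {i j k l : Fin n} (h : i ≠ j) (h' : k ≠ l) :
    edgeOf i j h = edgeOf k l h' ↔ s(i, j) = s(k, l) := by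
  unfold edgeOf
  rw [Sym2.eq_iff]
  split_ifs with h1 h2 h2 <;> simp only [Subtype.mk.injEq, Prod.mk.injEq] <;> omega

/-- The position above the diagonal visited by the `t`-th step of a walk without loops. -/
def walkEdge {n l : ℕ} (w : Fin (l + 1) → Fin n) (h : ∀ t : Fin l, w t.castSucc ≠ w t.succ)
    (t : Fin l) : EdgeIndex n :=
  edgeOf _ _ (h t)

theorem walkEdge_eq_iff {n l : ℕ} {w : Fin (l + 1) → Fin n}
    (h : ∀ t : Fin l, w t.castSucc ≠ w t.succ) (t t' : Fin l) :
    walkEdge w h t = walkEdge w h t' ↔ walkStep w t = walkStep w t' :=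
  edgeOf_eq_iff _ _

/-- The number of times the walk `w` traverses the edge `e`. -/
def edgeMult {n l : ℕ} (w : Fin (l + 1) → Fin n) (h : ∀ t : Fin l, w t.castSucc ≠ w t.succ)
    (e : EdgeIndex n) : ℕ :=
  (Finset.univ.filter fun t => walkEdge w h t = e).card

theorem prod_symmMatrix_eq {n l : ℕ} (ξ : EdgeIndex n → ℝ) {w : Fin (l + 1) → Fin n}
    (h : ∀ t : Fin l, w t.castSucc ≠ w t.succ) :
    ∏ t : Fin l, symmMatrix ξ (w t.castSucc) (w t.succ) = ∏ e, ξ e ^ edgeMult w h e := by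
  rw [← Finset.prod_fiberwise Finset.univ (walkEdge w h)]
  refine Finset.prod_congr rfl fun e _ => ?_
  rw [edgeMult, ← Finset.prod_const]
  refine Finset.prod_congr rfl fun t ht => ?_
  rw [symmMatrix_apply_of_ne ξ (h t), ← (Finset.mem_filter.mp ht).2, walkEdge]

theorem edgeMult_ne_one_iff {n l : ℕ} {w : Fin (l + 1) → Fin n}
    (h : ∀ t : Fin l, w t.castSucc ≠ w t.succ) :
    (∀ e, edgeMult w h e ≠ 1) ↔ ∀ t, ∃ t', t' ≠ t ∧ walkStep w t' = walkStep w t := by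
  constructor
  · intro H t
    by_contra! hno
    refine H (walkEdge w h t) (Finset.card_eq_one.mpr ⟨t, ?_⟩)
    ext t'
    simp only [Finset.mem_filter, Finset.mem_univ, true_and, Finset.mem_singleton, walkEdge_eq_iff]
    exact ⟨fun h1 => by_contra fun h2 => hno t' h2 h1, fun h1 => by rw [h1]⟩
  · intro H e he
    obtain ⟨t, ht⟩ := Finset.card_eq_one.mp he
    have h1 : walkEdge w h t = e := by
      have : t ∈ Finset.univ.filter fun t => walkEdge w h t = e := by rw [ht]; simp
      simpa using this
    obtain ⟨t', hne, ht'⟩ := H t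
    have : t' ∈ Finset.univ.filter fun t => walkEdge w h t = e := by
      simp only [Finset.mem_filter, Finset.mem_univ, true_and]
      rw [← h1, walkEdge_eq_iff, ht']
    rw [ht, Finset.mem_singleton] at this
    exact hne this

open Classical in
/-- The expected weight of a closed walk vanishes unless the walk is recurrent, and each edge of a
recurrent walk costs a factor `p`. -/
theorem abs_prod_moments_le {n l : ℕ} {w : Fin (l + 1) → Fin n}
    (h : ∀ t : Fin l, w t.castSucc ≠ w t.succ) (hw : w 0 = w (Fin.last l))
    (a : EdgeIndex n → ℕ → ℝ) {p : ℝ} (hp : 0 ≤ p) (hp1 : p ≤ 1) (h0 : ∀ e, a e 0 = 1)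
    (h1 : ∀ e, a e 1 = 0) (h2 : ∀ e q, 2 ≤ q → |a e q| ≤ p) :
    |∏ e, a e (edgeMult w h e)|
      ≤ if IsRecurrentWalk w then p ^ ((Finset.univ.image w).card - 1) else 0 := by
  by_cases hne : ∀ e, edgeMult w h e ≠ 1
  · rw [if_pos ⟨hw, h, (edgeMult_ne_one_iff h).mp hne⟩, Finset.abs_prod]
    have hedges : (Finset.univ.filter fun e => edgeMult w h e ≠ 0).card
        = (Finset.univ.image (walkStep w)).card := by
      have hset : (Finset.univ.filter fun e => edgeMult w h e ≠ 0)
          = Finset.univ.image (walkEdge w h) := by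
        ext e
        simp [edgeMult, Finset.filter_eq_empty_iff]
      rw [hset]
      exact le_antisymm
        (card_image_le_card_image_of_forall _ fun t t' => (walkEdge_eq_iff h t t').mpr)
        (card_image_le_card_image_of_forall _ fun t t' => (walkEdge_eq_iff h t t').mp)
    calc ∏ e, |a e (edgeMult w h e)|
        ≤ ∏ e, (if edgeMult w h e ≠ 0 then p else 1) := by
          refine Finset.prod_le_prod (fun e _ => abs_nonneg _) fun e _ => ?_
          split_ifs with h'
          · exact h2 e _ (by have := hne e; omega)
          · rw [not_not.mp h', h0, abs_one]
      _ = p ^ (Finset.univ.image (walkStep w)).card := by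
          rw [← Finset.prod_filter, Finset.prod_const, hedges]
      _ ≤ p ^ ((Finset.univ.image w).card - 1) := by
          refine pow_le_pow_of_le_one hp hp1 ?_
          have := card_image_le_card_image_walkStep w
          omega
  · push Not at hne
    obtain ⟨e, he⟩ := hne
    rw [Finset.prod_eq_zero (Finset.mem_univ e) (by rw [he, h1]), abs_zero]
    split_ifs <;> positivity

open Classical in
/-- Moments that vanish at order one and are at least one at all other orders detect recurrent
walks. -/
theorem le_prod_moments {n l : ℕ} {w : Fin (l + 1) → Fin n}
    (h : ∀ t : Fin l, w t.castSucc ≠ w t.succ)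
    (a : ℕ → ℝ) (h1 : a 1 = 0) (h2 : ∀ q, q ≠ 1 → 1 ≤ a q) :
    (if IsRecurrentWalk w then (1 : ℝ) else 0) ≤ ∏ e, a (edgeMult w h e) := by
  split_ifs with hw
  · exact Finset.one_le_prod fun e _ => h2 _ ((edgeMult_ne_one_iff h).mpr hw.2.2 e)
  · refine Finset.prod_nonneg fun e _ => ?_
    by_cases hq : edgeMult w h e = 1
    · rw [hq, h1]
    · exact zero_le_one.trans (h2 _ hq)

end Edges

/-! ### A comparison matrix with bounded entries -/

section Comparison

open scoped Matrix.Norms.L2Operator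

/-- The values of a centred three-point variable, under the uniform distribution, all of whose
moments of order other than one are at least one. -/
def skewSign : Fin 3 → ℝ := ![2, -1, -1]

theorem sum_skewSign_pow_one : ∑ b, skewSign b ^ 1 = 0 := by
  simp only [skewSign, Fin.sum_univ_three, Matrix.cons_val]
  norm_num

theorem three_le_sum_skewSign_pow {q : ℕ} (hq : q ≠ 1) : 3 ≤ ∑ b, skewSign b ^ q := by
  simp only [skewSign, Fin.sum_univ_three, Matrix.cons_val]
  rcases q with _ | _ | _ | q
  · norm_num
  · omega
  · norm_num
  · have h1 : (2 : ℝ) ^ 3 ≤ 2 ^ (q + 3) := pow_le_pow_right₀ (by norm_num) (by omega)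
    have h2 : -1 ≤ (-1 : ℝ) ^ (q + 3) := by
      rcases neg_one_pow_eq_or ℝ (q + 3) with h | h <;> rw [h]; norm_num
    change 3 ≤ (2 : ℝ) ^ (q + 3) + (-1) ^ (q + 3) + (-1) ^ (q + 3)
    linarith

theorem sum_exp_skewSign_le (t : ℝ) :
    ∑ b, Real.exp (t * skewSign b) ≤ 3 * Real.exp (9 / 2 * t ^ 2) := by
  have hsum : ∀ s : ℝ, ∑ b, Real.exp (s * skewSign b) = Real.exp (2 * s) + 2 * Real.exp (-s) := by
    intro s
    simp only [skewSign, Fin.sum_univ_three, Matrix.cons_val]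
    rw [mul_comm s 2, mul_neg_one]
    ring
  -- Multiplying by the exponential moment at `-t`, which is at least `1`, symmetrizes the variable.
  have h1 : 3 ≤ Real.exp (2 * -t) + 2 * Real.exp t := by
    have := Real.add_one_le_exp (2 * -t)
    have := Real.add_one_le_exp t
    linarith
  have h2 : (Real.exp (2 * t) + 2 * Real.exp (-t)) * (Real.exp (2 * -t) + 2 * Real.exp t)
      = 5 + 4 * Real.cosh (3 * t) := by
    rw [Real.cosh_eq]
    have e1 : Real.exp (2 * t) * Real.exp (2 * -t) = 1 := by rw [← Real.exp_add]; simp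
    have e2 : Real.exp (-t) * Real.exp t = 1 := by rw [← Real.exp_add]; simp
    have e3 : Real.exp (2 * t) * Real.exp t = Real.exp (3 * t) := by
      rw [← Real.exp_add]; ring_nf
    have e4 : Real.exp (-t) * Real.exp (2 * -t) = Real.exp (-(3 * t)) := by
      rw [← Real.exp_add]; ring_nf
    linear_combination e1 + 4 * e2 + 2 * e3 + 2 * e4
  have h3 : Real.cosh (3 * t) ≤ Real.exp (9 / 2 * t ^ 2) := by
    refine (Real.cosh_le_exp_half_sq (3 * t)).trans (le_of_eq ?_)
    congr 1
    ring
  have h4 : 1 ≤ Real.exp (9 / 2 * t ^ 2) := Real.one_le_exp (by positivity)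
  rw [hsum]
  have h5 : 0 < Real.exp (2 * t) + 2 * Real.exp (-t) := by positivity
  nlinarith

open Classical in
/-- The number of recurrent walks is at most the average trace of a power of the symmetric matrix
with independent three-point entries. -/
theorem card_recurrentWalk_le (r l : ℕ) :
    (3 : ℝ) ^ Fintype.card (EdgeIndex r)
        * (Finset.univ.filter fun w : Fin (l + 1) → Fin r => IsRecurrentWalk w).card
      ≤ ∑ y : EdgeIndex r → Fin 3, ((symmMatrix fun e => skewSign (y e)) ^ l).trace := by
  simp only [matrix_trace_pow]
  rw [Finset.sum_comm, Finset.card_eq_sum_ones, Nat.cast_sum, Finset.sum_filter, Finset.mul_sum]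
  refine Finset.sum_le_sum fun w _ => ?_
  by_cases hw : w 0 = w (Fin.last l)
  swap
  · rw [if_neg (fun h => hw h.1)]
    simp [hw]
  simp only [hw, if_true]
  by_cases hl : ∀ t : Fin l, w t.castSucc ≠ w t.succ
  swap
  · rw [if_neg (fun h => hl h.2.1), mul_zero]
    push Not at hl
    obtain ⟨t, ht⟩ := hl
    refine Finset.sum_nonneg fun y _ => ?_
    rw [Finset.prod_eq_zero (Finset.mem_univ t) (by rw [ht, symmMatrix_apply_self])]
  simp only [prod_symmMatrix_eq _ hl]
  have hfac : ∑ y : EdgeIndex r → Fin 3, ∏ e, skewSign (y e) ^ edgeMult w hl e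
      = 3 ^ Fintype.card (EdgeIndex r)
        * ∏ e, ((∑ b, skewSign b ^ edgeMult w hl e) / 3) := by
    rw [Finset.prod_div_distrib, Finset.prod_const, Finset.card_univ,
      mul_div_cancel₀ _ (by positivity),
      Finset.prod_univ_sum, Fintype.piFinset_univ]
  rw [hfac]
  refine mul_le_mul_of_nonneg_left ?_ (by positivity)
  have := le_prod_moments hl (fun q => (∑ b, skewSign b ^ q) / 3)
    (by simp only [sum_skewSign_pow_one, zero_div])
    (fun q hq => by have := three_le_sum_skewSign_pow hq; linarith)
  simpa using this

/-- A maximal separated subset of a ball is a net of exponential size. -/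
theorem exists_net (r : ℕ) : ∃ S : Finset (EuclideanSpace ℝ (Fin r)),
    S.card ≤ 5 ^ r ∧ (∀ s ∈ S, ‖s‖ ≤ 2) ∧ ∀ x, ‖x‖ ≤ 2 → ∃ s ∈ S, ‖x - s‖ ≤ 1 := by
  classical
  let Q : ℕ → Prop := fun N => ∃ S : Finset (EuclideanSpace ℝ (Fin r)), S.card = N ∧
    (∀ s ∈ S, ‖s‖ ≤ 2) ∧ ∀ c ∈ S, ∀ d ∈ S, c ≠ d → 1 ≤ ‖c - d‖
  have hbound : ∀ N, Q N → N ≤ 5 ^ r := by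
    rintro N ⟨S, rfl, h1, h2⟩
    simpa using Besicovitch.card_le_of_separated S h1 h2
  have h0 : Q 0 := ⟨∅, by simp⟩
  obtain ⟨S, hcard, hS, hsep⟩ := Nat.findGreatest_spec (P := Q) (Nat.zero_le (5 ^ r)) h0
  refine ⟨S, hcard ▸ Nat.findGreatest_le _, hS, fun x hx => ?_⟩
  by_contra! hno
  have hxS : x ∉ S := fun h => by
    have := hno x h
    simp at this
    linarith
  have hQ : Q (S.card + 1) := by
    refine ⟨insert x S, Finset.card_insert_of_notMem hxS, ?_, ?_⟩
    · intro s hs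
      rcases Finset.mem_insert.mp hs with rfl | h
      exacts [hx, hS s h]
    · intro c hc d hd hcd
      rcases Finset.mem_insert.mp hc with rfl | hc' <;>
        rcases Finset.mem_insert.mp hd with rfl | hd'
      · exact absurd rfl hcd
      · exact (hno d hd').le
      · rw [norm_sub_rev]; exact (hno c hc').le
      · exact hsep c hc' d hd' hcd
  have := Nat.le_findGreatest (hbound _ hQ) hQ
  omega

/-- The bilinear form of `Y` on a `1`-net of the ball of radius `2` dominates `‖Y‖`: as the radius is
twice the mesh, absorbing the approximation errors costs no constant. -/
theorem exists_opNorm_le_inner {r : ℕ} {S : Finset (EuclideanSpace ℝ (Fin r))}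
    (hS : ∀ x, ‖x‖ ≤ 2 → ∃ s ∈ S, ‖x - s‖ ≤ 1) (Y : Matrix (Fin r) (Fin r) ℝ) :
    ∃ s ∈ S, ∃ s' ∈ S, ‖Y‖ ≤ inner ℝ s (Matrix.toEuclideanLin Y s') := by
  have hne : S.Nonempty := by
    obtain ⟨s, hs, -⟩ := hS 0 (by simp)
    exact ⟨s, hs⟩
  obtain ⟨s', hs', hmax'⟩ := S.exists_max_image (fun s => ‖Matrix.toEuclideanLin Y s‖) hne
  set z := Matrix.toEuclideanLin Y s' with hz
  have h1 : ‖Y‖ ≤ ‖z‖ := by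
    have : ‖Y‖ ≤ (‖z‖ + ‖Y‖) / 2 := by
      refine opNorm_le_of_forall Y (by positivity) fun x => ?_
      rcases eq_or_ne x 0 with rfl | hx
      · simp
      have hx' : 0 < ‖x‖ := norm_pos_iff.mpr hx
      obtain ⟨s, hs, hxs⟩ := hS ((2 / ‖x‖) • x) (by
        rw [norm_smul, Real.norm_eq_abs, abs_of_pos (by positivity), div_mul_cancel₀ _ hx'.ne'])
      have h2 := norm_toEuclideanLin_le Y ((2 / ‖x‖) • x - s)
      have h3 : ‖Y‖ * ‖(2 / ‖x‖) • x - s‖ ≤ ‖Y‖ := mul_le_of_le_one_right (norm_nonneg _) hxs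
      have h4 := norm_le_norm_add_norm_sub' (Matrix.toEuclideanLin Y ((2 / ‖x‖) • x))
        (Matrix.toEuclideanLin Y s)
      rw [map_sub] at h2
      have h5 := hmax' s hs
      have h6 : ‖Matrix.toEuclideanLin Y ((2 / ‖x‖) • x)‖
          = 2 / ‖x‖ * ‖Matrix.toEuclideanLin Y x‖ := by
        rw [map_smul, norm_smul, Real.norm_eq_abs, abs_of_pos (by positivity)]
      rw [h6] at h4
      have h7 : 2 / ‖x‖ * ‖Matrix.toEuclideanLin Y x‖ ≤ ‖z‖ + ‖Y‖ := by linarith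
      rw [div_mul_eq_mul_div, div_le_iff₀ hx'] at h7
      linarith
    linarith
  obtain ⟨s, hs, hmax⟩ := S.exists_max_image (fun s => (inner ℝ s z : ℝ)) hne
  refine ⟨s, hs, s', hs', h1.trans ?_⟩
  rcases eq_or_ne z 0 with h0 | h0
  · rw [← hz, h0, norm_zero, inner_zero_right]
  have hz' : 0 < ‖z‖ := norm_pos_iff.mpr h0
  obtain ⟨u, hu, hzu⟩ := hS ((2 / ‖z‖) • z) (by
    rw [norm_smul, Real.norm_eq_abs, abs_of_pos (by positivity), div_mul_cancel₀ _ hz'.ne'])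
  have h2 : (inner ℝ ((2 / ‖z‖) • z) z : ℝ) = 2 * ‖z‖ := by
    rw [inner_smul_left, real_inner_self_eq_norm_sq]
    simp only [conj_trivial]
    field_simp
  have h3 : (inner ℝ ((2 / ‖z‖) • z - u) z : ℝ) ≤ ‖z‖ :=
    (real_inner_le_norm _ _).trans (mul_le_of_le_one_left (norm_nonneg _) hzu)
  rw [inner_sub_left, h2] at h3
  have h4 := hmax u hu
  linarith

end Comparison

/-! ### Moments of the comparison matrix and the number of walks -/

section ComparisonMoments

open scoped Matrix.Norms.L2Operator

theorem trace_pow_two_mul {n : ℕ} {Y : Matrix (Fin n) (Fin n) ℝ} (hY : Yᵀ = Y) (k : ℕ) :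
    (Y ^ (2 * k)).trace = frobeniusNorm (Y ^ k) ^ 2 := by
  rw [frobeniusNorm_sq_eq_trace, Matrix.transpose_pow, hY, ← pow_add, two_mul]

theorem trace_pow_two_mul_le {n : ℕ} {Y : Matrix (Fin n) (Fin n) ℝ} (hY : Yᵀ = Y) {k : ℕ}
    (hk : 1 ≤ k) : (Y ^ (2 * k)).trace ≤ n * ‖Y‖ ^ (2 * k) := by
  rw [trace_pow_two_mul hY]
  have h1 := frobeniusNorm_le_sqrt_rank_mul (Y ^ k)
  have h2 : ‖Y ^ k‖ ≤ ‖Y‖ ^ k := norm_pow_le' Y hk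
  calc frobeniusNorm (Y ^ k) ^ 2 ≤ (√((Y ^ k).rank : ℝ) * ‖Y ^ k‖) ^ 2 :=
        pow_le_pow_left₀ (frobeniusNorm_nonneg _) h1 2
    _ = (Y ^ k).rank * ‖Y ^ k‖ ^ 2 := by rw [mul_pow, Real.sq_sqrt (by positivity)]
    _ ≤ n * (‖Y‖ ^ k) ^ 2 := by
        gcongr
        exact_mod_cast (Matrix.rank_le_width _)
    _ = _ := by rw [← pow_mul, mul_comm k 2]

theorem sum_edgeIndex_add_diag {n : ℕ} (f : Fin n → Fin n → ℝ) :
    ∑ e : EdgeIndex n, (f e.1.1 e.1.2 + f e.1.2 e.1.1) + ∑ i, f i i = ∑ i, ∑ j, f i j := by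
  have h1 : ∑ e : EdgeIndex n, (f e.1.1 e.1.2 + f e.1.2 e.1.1)
      = ∑ i, ∑ j, if i < j then f i j + f j i else 0 := by
    rw [← Fintype.sum_prod_type' (f := fun i j : Fin n => if i < j then f i j + f j i else 0),
      ← Finset.sum_filter]
    exact (Finset.sum_subtype _ (by simp) fun e : Fin n × Fin n => f e.1 e.2 + f e.2 e.1).symm
  have h2 : ∑ i, ∑ j, (if i < j then f i j + f j i else 0)
      = ∑ i, ∑ j, ((if i < j then f i j else 0) + if j < i then f i j else 0) := by
    simp only [Finset.sum_add_distrib]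
    rw [Finset.sum_comm (f := fun i j => if j < i then f i j else 0), ← Finset.sum_add_distrib]
    refine Finset.sum_congr rfl fun i _ => ?_
    rw [← Finset.sum_add_distrib]
    refine Finset.sum_congr rfl fun j _ => ?_
    split_ifs <;> simp
  have h3 : ∑ i, f i i = ∑ i, ∑ j, if i = j then f i j else 0 := by simp
  rw [h1, h2, h3, ← Finset.sum_add_distrib]
  refine Finset.sum_congr rfl fun i _ => ?_
  rw [← Finset.sum_add_distrib]
  refine Finset.sum_congr rfl fun j _ => ?_
  rcases lt_trichotomy i j with h | h | h
  · simp [h, h.ne, h.asymm]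
  · simp [h]
  · simp [h, h.ne', h.asymm]

theorem inner_symmMatrix {n : ℕ} (ξ : EdgeIndex n → ℝ) (x y : EuclideanSpace ℝ (Fin n)) :
    inner ℝ x (Matrix.toEuclideanLin (symmMatrix ξ) y)
      = ∑ e : EdgeIndex n, (x e.1.1 * y e.1.2 + x e.1.2 * y e.1.1) * ξ e := by
  have h1 : inner ℝ x (Matrix.toEuclideanLin (symmMatrix ξ) y)
      = ∑ i, ∑ j, x i * (symmMatrix ξ i j * y j) := by
    simp [PiLp.inner_apply, Matrix.mulVec, dotProduct, Finset.mul_sum, mul_comm]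
  rw [h1, ← sum_edgeIndex_add_diag]
  simp only [symmMatrix_apply_self, zero_mul, mul_zero, Finset.sum_const_zero, add_zero]
  refine Finset.sum_congr rfl fun e _ => ?_
  have h2 : symmMatrix ξ e.1.1 e.1.2 = ξ e := by simp [symmMatrix, e.2]
  have h3 : symmMatrix ξ e.1.2 e.1.1 = ξ e := by simp [symmMatrix, e.2, e.2.asymm]
  rw [h2, h3]
  ring

theorem sum_edgeIndex_sq_le {n : ℕ} (x y : EuclideanSpace ℝ (Fin n)) :
    ∑ e : EdgeIndex n, (x e.1.1 * y e.1.2 + x e.1.2 * y e.1.1) ^ 2 ≤ 2 * (‖x‖ ^ 2 * ‖y‖ ^ 2) := by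
  have h1 := sum_edgeIndex_add_diag fun i j => x i ^ 2 * y j ^ 2
  have h2 : 0 ≤ ∑ i, x i ^ 2 * y i ^ 2 := Finset.sum_nonneg fun i _ => by positivity
  rw [EuclideanSpace.real_norm_sq_eq, EuclideanSpace.real_norm_sq_eq, Finset.sum_mul_sum, ← h1]
  calc _ ≤ ∑ e : EdgeIndex n,
        2 * (x e.1.1 ^ 2 * y e.1.2 ^ 2 + x e.1.2 ^ 2 * y e.1.1 ^ 2) := by
        refine Finset.sum_le_sum fun e _ => ?_
        nlinarith [sq_nonneg (x e.1.1 * y e.1.2 - x e.1.2 * y e.1.1)]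
    _ ≤ _ := by rw [← Finset.mul_sum]; linarith

theorem sum_exp_linear_skewSign_le {ι : Type*} [Fintype ι] [DecidableEq ι] (c : ι → ℝ) :
    ∑ y : ι → Fin 3, Real.exp (∑ e, c e * skewSign (y e))
      ≤ 3 ^ Fintype.card ι * Real.exp (9 / 2 * ∑ e, c e ^ 2) := by
  simp only [Real.exp_sum]
  rw [← Fintype.piFinset_univ, ← Finset.prod_univ_sum (fun _ => Finset.univ)
    (fun e b => Real.exp (c e * skewSign b))]
  refine (Finset.prod_le_prod (fun e _ => Finset.sum_nonneg fun b _ => (Real.exp_pos _).le)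
    fun e _ => sum_exp_skewSign_le (c e)).trans (le_of_eq ?_)
  rw [Finset.prod_mul_distrib, Finset.prod_const, Finset.card_univ, Finset.mul_sum, Real.exp_sum]

theorem pow_two_mul_le_exp (s : ℝ) (k : ℕ) :
    s ^ (2 * k) ≤ (2 * k) ^ k * (Real.exp (√(2 * k) * s) + Real.exp (-(√(2 * k) * s))) := by
  rcases k.eq_zero_or_pos with rfl | hk
  · simp
  have hk' : (0 : ℝ) < 2 * k := by positivity
  have h1 := Real.pow_div_factorial_le_exp (√(2 * k) * |s|) (by positivity) (2 * k)
  have h2 : (√(2 * (k : ℝ)) * |s|) ^ (2 * k) = (2 * k) ^ k * s ^ (2 * k) := by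
    rw [mul_pow, pow_mul, Real.sq_sqrt hk'.le, pow_mul |s|, sq_abs, ← pow_mul]
  have h3 : ((2 * k).factorial : ℝ) ≤ (2 * k) ^ k * (2 * k) ^ k := by
    rw [← pow_add, ← two_mul]
    exact_mod_cast Nat.factorial_le_pow (2 * k)
  have h4 : Real.exp (√(2 * k) * |s|)
      ≤ Real.exp (√(2 * k) * s) + Real.exp (-(√(2 * k) * s)) := by
    rcases abs_cases s with ⟨h, -⟩ | ⟨h, -⟩ <;> rw [h]
    · exact le_add_of_nonneg_right (Real.exp_pos _).le
    · rw [mul_neg]; exact le_add_of_nonneg_left (Real.exp_pos _).le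
  rw [h2, div_le_iff₀ (by positivity)] at h1
  have h5 : (2 * (k : ℝ)) ^ k * s ^ (2 * k)
      ≤ (2 * k) ^ k * ((2 * k) ^ k * Real.exp (√(2 * k) * |s|)) := by
    calc _ ≤ _ := h1
      _ ≤ Real.exp (√(2 * k) * |s|) * ((2 * k) ^ k * (2 * k) ^ k) := by gcongr
      _ = _ := by ring
  refine (le_of_mul_le_mul_left h5 (by positivity)).trans ?_
  gcongr

/-- Subgaussian moment bound for a linear combination of independent three-point variables, summed
over the `3 ^ card ι` outcomes instead of averaged. -/
theorem sum_linear_skewSign_pow_le {ι : Type*} [Fintype ι] [DecidableEq ι] (c : ι → ℝ) (k : ℕ) :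
    ∑ y : ι → Fin 3, (∑ e, c e * skewSign (y e)) ^ (2 * k)
      ≤ 3 ^ Fintype.card ι * (2 * (2 * k) ^ k * Real.exp (9 * k * ∑ e, c e ^ 2)) := by
  have key : ∀ u : ℝ, u ^ 2 = 2 * k → ∑ y : ι → Fin 3, Real.exp (u * ∑ e, c e * skewSign (y e))
      ≤ 3 ^ Fintype.card ι * Real.exp (9 * k * ∑ e, c e ^ 2) := by
    intro u hu
    have := sum_exp_linear_skewSign_le fun e => u * c e
    simp only [mul_pow, ← Finset.mul_sum, hu, mul_assoc u] at this
    refine this.trans (le_of_eq ?_)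
    congr 2
    ring
  have hsq : √(2 * (k : ℝ)) ^ 2 = 2 * k := Real.sq_sqrt (by positivity)
  calc _ ≤ ∑ y : ι → Fin 3, (2 * (k : ℝ)) ^ k
        * (Real.exp (√(2 * k) * ∑ e, c e * skewSign (y e))
          + Real.exp (-√(2 * k) * ∑ e, c e * skewSign (y e))) := by
        refine Finset.sum_le_sum fun y _ => ?_
        rw [neg_mul]
        exact pow_two_mul_le_exp _ k
    _ = (2 * (k : ℝ)) ^ k * (∑ y : ι → Fin 3, Real.exp (√(2 * k) * ∑ e, c e * skewSign (y e))
          + ∑ y : ι → Fin 3, Real.exp (-√(2 * k) * ∑ e, c e * skewSign (y e))) := by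
        rw [← Finset.mul_sum, Finset.sum_add_distrib]
    _ ≤ (2 * (k : ℝ)) ^ k * (3 ^ Fintype.card ι * Real.exp (9 * k * ∑ e, c e ^ 2)
          + 3 ^ Fintype.card ι * Real.exp (9 * k * ∑ e, c e ^ 2)) := by
        gcongr
        · exact key _ hsq
        · exact key _ (by rw [neg_sq, hsq])
    _ = _ := by ring

/-- The constant in the bound for the number of recurrent walks; its value is immaterial. -/
noncomputable def walkConst : ℝ := 10000 * Real.exp 288

theorem walkConst_pos : 0 < walkConst := by unfold walkConst; positivity

theorem sum_trace_symmMatrix_skewSign_le (r : ℕ) {k : ℕ} (hk : 1 ≤ k) :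
    ∑ y : EdgeIndex r → Fin 3, ((symmMatrix fun e => skewSign (y e)) ^ (2 * k)).trace
      ≤ 3 ^ Fintype.card (EdgeIndex r)
        * (r * (25 ^ r * (2 * (2 * k) ^ k * Real.exp (288 * k)))) := by
  obtain ⟨S, hcard, hS2, hS⟩ := exists_net r
  have h1 : ∀ y : EdgeIndex r → Fin 3,
      ((symmMatrix fun e => skewSign (y e)) ^ (2 * k)).trace
        ≤ r * ∑ s ∈ S, ∑ s' ∈ S, (∑ e : EdgeIndex r,
          (s e.1.1 * s' e.1.2 + s e.1.2 * s' e.1.1) * skewSign (y e)) ^ (2 * k) := by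
    intro y
    refine (trace_pow_two_mul_le (symmMatrix_transpose _) hk).trans ?_
    gcongr
    obtain ⟨s, hs, s', hs', h⟩ := exists_opNorm_le_inner hS (symmMatrix fun e => skewSign (y e))
    refine (pow_le_pow_left₀ (norm_nonneg _) h (2 * k)).trans ?_
    rw [inner_symmMatrix]
    have hnn : ∀ z : ℝ, 0 ≤ z ^ (2 * k) := fun z => by rw [pow_mul]; positivity
    refine le_trans ?_ (Finset.single_le_sum (fun a _ => Finset.sum_nonneg fun b _ => hnn _) hs)
    exact Finset.single_le_sum (f := fun s' => (∑ e : EdgeIndex r,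
          (s e.1.1 * s' e.1.2 + s e.1.2 * s' e.1.1) * skewSign (y e)) ^ (2 * k))
      (fun b _ => hnn _) hs'
  refine (Finset.sum_le_sum fun y _ => h1 y).trans ?_
  rw [← Finset.mul_sum, Finset.sum_comm]
  have h2 : ∀ s ∈ S, ∀ s' ∈ S, ∑ y : EdgeIndex r → Fin 3, (∑ e : EdgeIndex r,
      (s e.1.1 * s' e.1.2 + s e.1.2 * s' e.1.1) * skewSign (y e)) ^ (2 * k)
      ≤ 3 ^ Fintype.card (EdgeIndex r) * (2 * (2 * k) ^ k * Real.exp (288 * k)) := by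
    intro s hs s' hs'
    refine (sum_linear_skewSign_pow_le _ k).trans (mul_le_mul_of_nonneg_left
      (mul_le_mul_of_nonneg_left (Real.exp_le_exp.mpr ?_) (by positivity)) (by positivity))
    have h3 := sum_edgeIndex_sq_le s s'
    have h4 : ‖s‖ ^ 2 ≤ 2 ^ 2 := pow_le_pow_left₀ (norm_nonneg _) (hS2 s hs) 2
    have h5 : ‖s'‖ ^ 2 ≤ 2 ^ 2 := pow_le_pow_left₀ (norm_nonneg _) (hS2 s' hs') 2
    have h6 : ‖s‖ ^ 2 * ‖s'‖ ^ 2 ≤ 2 ^ 2 * 2 ^ 2 := mul_le_mul h4 h5 (by positivity) (by positivity)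
    calc _ ≤ 9 * (k : ℝ) * 32 := mul_le_mul_of_nonneg_left (by linarith) (by positivity)
      _ = 288 * k := by ring
  have h7 : ∑ s ∈ S, ∑ y : EdgeIndex r → Fin 3, ∑ s' ∈ S, (∑ e : EdgeIndex r,
      (s e.1.1 * s' e.1.2 + s e.1.2 * s' e.1.1) * skewSign (y e)) ^ (2 * k)
      ≤ ∑ s ∈ S, ∑ s' ∈ S,
        3 ^ Fintype.card (EdgeIndex r) * (2 * (2 * k) ^ k * Real.exp (288 * k)) := by
    refine Finset.sum_le_sum fun s hs => ?_
    rw [Finset.sum_comm]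
    exact Finset.sum_le_sum fun s' hs' => h2 s hs s' hs'
  have h8 : (S.card : ℝ) ≤ 5 ^ r := by exact_mod_cast hcard
  have h9 : (S.card : ℝ) * S.card ≤ 25 ^ r := by
    calc (S.card : ℝ) * S.card ≤ 5 ^ r * 5 ^ r := by gcongr
      _ = 25 ^ r := by rw [← mul_pow]; norm_num
  calc _ ≤ (r : ℝ) * ∑ s ∈ S, ∑ s' ∈ S,
        3 ^ Fintype.card (EdgeIndex r) * (2 * (2 * k) ^ k * Real.exp (288 * k)) := by gcongr
    _ = 3 ^ Fintype.card (EdgeIndex r) * (r * ((S.card * S.card)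
        * (2 * (2 * k) ^ k * Real.exp (288 * k)))) := by
        simp only [Finset.sum_const, nsmul_eq_mul]; ring
    _ ≤ _ := by gcongr

open Classical in
/-- The number of recurrent walks of length `2 k` on `2 k` vertices is at most `(C k) ^ k`. -/
theorem card_recurrentWalk_le_pow {k : ℕ} (hk : 1 ≤ k) :
    ((Finset.univ.filter fun w : Fin (2 * k + 1) → Fin (2 * k) => IsRecurrentWalk w).card : ℝ)
      ≤ (walkConst * k) ^ k := by
  have h1 := (card_recurrentWalk_le (2 * k) (2 * k)).trans
    (sum_trace_symmMatrix_skewSign_le (2 * k) hk)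
  refine (le_of_mul_le_mul_left h1 (by positivity)).trans ?_
  have h2 : (k : ℝ) ≤ 2 ^ k := by exact_mod_cast Nat.lt_two_pow_self.le
  have h3 : (4 : ℝ) ≤ 4 ^ k := le_self_pow₀ (by norm_num) (by omega)
  have h4 : Real.exp (288 * k) = Real.exp 288 ^ k := by rw [← Real.exp_nat_mul, mul_comm]
  push_cast
  calc 2 * (k : ℝ) * (25 ^ (2 * k) * (2 * (2 * k) ^ k * Real.exp (288 * k)))
      = (4 * k) * (625 ^ k * ((2 * k) ^ k * Real.exp 288 ^ k)) := by
        rw [h4, pow_mul]; norm_num; ring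
    _ ≤ (4 ^ k * 2 ^ k) * (625 ^ k * ((2 * k) ^ k * Real.exp 288 ^ k)) := by gcongr
    _ = (walkConst * k) ^ k := by
        simp only [← mul_pow, walkConst]
        congr 1
        ring

end ComparisonMoments

/-! ### Concentration of the adjacency matrix -/

section Concentration

open scoped Matrix.Norms.L2Operator

theorem le_maxEntry {N : ℕ} (M : Matrix (Fin N) (Fin N) ℝ) (i j : Fin N) :
    M i j ≤ maxEntry M :=
  le_ciSup (f := fun e : Fin N × Fin N => M e.1 e.2) (Set.finite_range _).bddAbove (i, j)

theorem maxEntry_nonneg {N : ℕ} {M : Matrix (Fin N) (Fin N) ℝ} (h : ∀ i j, 0 ≤ M i j) :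
    0 ≤ maxEntry M :=
  Real.iSup_nonneg fun e => h e.1 e.2

theorem maxEntry_le_one {N : ℕ} {M : Matrix (Fin N) (Fin N) ℝ} (h : ∀ i j, M i j ≤ 1) :
    maxEntry M ≤ 1 :=
  Real.iSup_le (fun e => h e.1 e.2) zero_le_one

theorem IsInhomogeneousErdosRenyi.block₁₁ {n m : ℕ} {Ω : Type*} [MeasurableSpace Ω]
    {μ : Measure Ω} {P : Matrix (Fin (n + m)) (Fin (n + m)) ℝ}
    {A : Ω → Matrix (Fin (n + m)) (Fin (n + m)) ℝ} (h : IsInhomogeneousErdosRenyi μ P A) :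
    IsInhomogeneousErdosRenyi μ (block₁₁ P) (fun ω => EgoLowRank.block₁₁ (A ω)) where
  prob_symm := by
    ext i j
    exact h.prob_symm.apply _ _
  prob_mem i j := h.prob_mem _ _
  measurable i j := h.measurable _ _
  adj_symm ω := by
    ext i j
    exact (h.adj_symm ω).apply _ _
  adj_mem ω i j := h.adj_mem ω _ _
  law i j hij := h.law _ _ ((Fin.strictMono_castAdd m) hij)
  indep := by
    let g : {e : Fin n × Fin n // e.1 < e.2} → {e : Fin (n + m) × Fin (n + m) // e.1 < e.2} :=
      fun e => ⟨(Fin.castAdd m e.1.1, Fin.castAdd m e.1.2), (Fin.strictMono_castAdd m) e.2⟩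
    have hg : Function.Injective g := by
      rintro ⟨⟨i, j⟩, h1⟩ ⟨⟨i', j'⟩, h2⟩ heq
      simpa [g, Fin.ext_iff] using heq
    exact h.indep.precomp hg

theorem IsInhomogeneousErdosRenyi.abs_sub_le {N : ℕ} {Ω : Type*} [MeasurableSpace Ω]
    {μ : Measure Ω} {P : Matrix (Fin N) (Fin N) ℝ} {A : Ω → Matrix (Fin N) (Fin N) ℝ}
    (h : IsInhomogeneousErdosRenyi μ P A) (ω : Ω) (i j : Fin N) : |A ω i j - P i j| ≤ 1 := by
  obtain ⟨h0, h1⟩ := h.prob_mem i j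
  rcases h.adj_mem ω i j with h2 | h2 <;> rw [h2, abs_le] <;> constructor <;> linarith

/-- The centred adjacency matrix, with its diagonal removed. -/
def centredAdj {N : ℕ} {Ω : Type*} (P : Matrix (Fin N) (Fin N) ℝ)
    (A : Ω → Matrix (Fin N) (Fin N) ℝ) (ω : Ω) : Matrix (Fin N) (Fin N) ℝ :=
  symmMatrix fun e => A ω e.1.1 e.1.2 - P e.1.1 e.1.2

theorem centredAdj_transpose {N : ℕ} {Ω : Type*} (P : Matrix (Fin N) (Fin N) ℝ)
    (A : Ω → Matrix (Fin N) (Fin N) ℝ) (ω : Ω) : (centredAdj P A ω)ᵀ = centredAdj P A ω :=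
  symmMatrix_transpose _

variable {N : ℕ} {Ω : Type*} [MeasurableSpace Ω] {μ : Measure Ω}
    {P : Matrix (Fin N) (Fin N) ℝ} {A : Ω → Matrix (Fin N) (Fin N) ℝ}

theorem IsInhomogeneousErdosRenyi.norm_sub_le (h : IsInhomogeneousErdosRenyi μ P A) (ω : Ω) :
    ‖A ω - P‖ ≤ ‖centredAdj P A ω‖ + 1 := by
  have : A ω - P = centredAdj P A ω + Matrix.diagonal fun i => A ω i i - P i i := by
    ext i j
    rcases lt_trichotomy i j with hij | rfl | hij
    · simp [centredAdj, symmMatrix, hij, hij.ne]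
    · simp [centredAdj, symmMatrix]
    · simp [centredAdj, symmMatrix, hij, hij.ne', hij.asymm, (h.adj_symm ω).apply i j,
        h.prob_symm.apply i j]
  rw [this]
  exact (norm_add_le _ _).trans (add_le_add le_rfl
    (opNorm_diagonal_le _ zero_le_one fun i => h.abs_sub_le ω i i))

theorem IsInhomogeneousErdosRenyi.integral_sub_pow (h : IsInhomogeneousErdosRenyi μ P A)
    (e : EdgeIndex N) (q : ℕ) : ∫ ω, (A ω e.1.1 e.1.2 - P e.1.1 e.1.2) ^ q ∂μ
      = P e.1.1 e.1.2 * (1 - P e.1.1 e.1.2) ^ q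
        + (1 - P e.1.1 e.1.2) * (-P e.1.1 e.1.2) ^ q := by
  have h1 := (h.law e.1.1 e.1.2 e.2).integral_comp
    (f := fun x : ℝ => (x - P e.1.1 e.1.2) ^ q) (by fun_prop)
  rw [integral_bernoulliMeasure] at h1
  simpa using h1

theorem IsInhomogeneousErdosRenyi.abs_centredAdj_le (h : IsInhomogeneousErdosRenyi μ P A)
    (ω : Ω) (i j : Fin N) : |centredAdj P A ω i j| ≤ 1 := by
  unfold centredAdj symmMatrix
  split_ifs
  · exact h.abs_sub_le _ _ _
  · exact h.abs_sub_le _ _ _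
  · simp

theorem IsInhomogeneousErdosRenyi.measurable_centredAdj (h : IsInhomogeneousErdosRenyi μ P A)
    (i j : Fin N) : Measurable fun ω => centredAdj P A ω i j := by
  unfold centredAdj symmMatrix
  split_ifs
  · exact (h.measurable _ _).sub_const _
  · exact (h.measurable _ _).sub_const _
  · exact measurable_const

theorem IsInhomogeneousErdosRenyi.integrable_prod [IsProbabilityMeasure μ]
    (h : IsInhomogeneousErdosRenyi μ P A)
    {l : ℕ} (w : Fin (l + 1) → Fin N) :
    Integrable (fun ω => ∏ t : Fin l, centredAdj P A ω (w t.castSucc) (w t.succ)) μ := by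
  refine Integrable.of_bound (C := 1) (Measurable.aestronglyMeasurable
    (Finset.measurable_fun_prod _ fun t _ => h.measurable_centredAdj _ _))
    (ae_of_all _ fun ω => ?_)
  rw [Real.norm_eq_abs, Finset.abs_prod]
  exact Finset.prod_le_one (fun t _ => abs_nonneg _) fun t _ => h.abs_centredAdj_le ω _ _

theorem IsInhomogeneousErdosRenyi.integrable_trace_pow [IsProbabilityMeasure μ]
    (h : IsInhomogeneousErdosRenyi μ P A) (l : ℕ) :
    Integrable (fun ω => (centredAdj P A ω ^ l).trace) μ := by
  simp only [matrix_trace_pow]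
  refine integrable_finsetSum _ fun w _ => ?_
  split_ifs
  · exact h.integrable_prod w
  · exact integrable_zero _ _ _

open Classical in
/-- By independence the expected weight of a walk is a product of moments of centred Bernoulli
variables, which are at most `p` in absolute value from order two on. -/
theorem IsInhomogeneousErdosRenyi.integral_prod_le [IsProbabilityMeasure μ]
    (h : IsInhomogeneousErdosRenyi μ P A) {p : ℝ}
    (hp : 0 ≤ p) (hp1 : p ≤ 1) (hPp : ∀ i j, P i j ≤ p)
    {l : ℕ} {w : Fin (l + 1) → Fin N} (hw : w 0 = w (Fin.last l)) :
    ∫ ω, ∏ t : Fin l, centredAdj P A ω (w t.castSucc) (w t.succ) ∂μ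
      ≤ if IsRecurrentWalk w then p ^ ((Finset.univ.image w).card - 1) else 0 := by
  by_cases hl : ∀ t : Fin l, w t.castSucc ≠ w t.succ
  swap
  · rw [if_neg (fun h => hl h.2.1)]
    push Not at hl
    obtain ⟨t, ht⟩ := hl
    refine le_of_eq ?_
    rw [← integral_zero Ω ℝ (μ := μ)]
    congr 1
    funext ω
    exact Finset.prod_eq_zero (Finset.mem_univ t) (by rw [ht, centredAdj, symmMatrix_apply_self])
  have h1 : ∫ ω, ∏ t : Fin l, centredAdj P A ω (w t.castSucc) (w t.succ) ∂μ
      = ∏ e : EdgeIndex N, ∫ ω, (A ω e.1.1 e.1.2 - P e.1.1 e.1.2) ^ edgeMult w hl e ∂μ := by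
    simp only [centredAdj, prod_symmMatrix_eq _ hl]
    have hind : iIndepFun (fun (e : EdgeIndex N) ω =>
        (A ω e.1.1 e.1.2 - P e.1.1 e.1.2) ^ edgeMult w hl e) μ :=
      h.indep.comp (fun e (x : ℝ) => (x - P e.1.1 e.1.2) ^ edgeMult w hl e)
        fun e => by fun_prop
    exact hind.integral_fun_prod_eq_prod_integral fun e =>
      (((h.measurable _ _).sub_const _).pow_const _).aestronglyMeasurable
  rw [h1]
  refine (le_abs_self _).trans (abs_prod_moments_le hl hw
    (fun e q => ∫ ω, (A ω e.1.1 e.1.2 - P e.1.1 e.1.2) ^ q ∂μ) hp hp1 ?_ ?_ ?_)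
  · intro e
    simp
  · intro e
    rw [h.integral_sub_pow]
    ring
  · intro e q hq
    rw [h.integral_sub_pow]
    obtain ⟨h0, h1⟩ := h.prob_mem e.1.1 e.1.2
    have hle := hPp e.1.1 e.1.2
    set x := P e.1.1 e.1.2
    have h2 : (1 - x) ^ q ≤ (1 - x) ^ 2 := pow_le_pow_of_le_one (by linarith) (by linarith) hq
    have h3 : |(-x) ^ q| ≤ x ^ 2 := by
      rw [abs_pow, abs_neg, abs_of_nonneg h0]
      exact pow_le_pow_of_le_one h0 h1 hq
    have h4 : 0 ≤ (1 - x) ^ q := pow_nonneg (by linarith) q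
    calc |x * (1 - x) ^ q + (1 - x) * (-x) ^ q|
        ≤ |x * (1 - x) ^ q| + |(1 - x) * (-x) ^ q| := abs_add_le _ _
      _ = x * (1 - x) ^ q + (1 - x) * |(-x) ^ q| := by
          rw [abs_of_nonneg (mul_nonneg h0 h4), abs_mul, abs_of_nonneg (by linarith : 0 ≤ 1 - x)]
      _ ≤ x * (1 - x) ^ 2 + (1 - x) * x ^ 2 :=
          add_le_add (mul_le_mul_of_nonneg_left h2 h0)
            (mul_le_mul_of_nonneg_left h3 (by linarith))
      _ ≤ p := by nlinarith [mul_nonneg h0 h0]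

/-- Moment bound: the expected trace of the `2 k`-th power of the centred adjacency matrix is at
most `N (C k) ^ k` as soon as `k` is at least the largest expected degree. -/
theorem IsInhomogeneousErdosRenyi.integral_trace_pow_le [IsProbabilityMeasure μ]
    (h : IsInhomogeneousErdosRenyi μ P A) {p : ℝ}
    (hp : 0 ≤ p) (hp1 : p ≤ 1) (hPp : ∀ i j, P i j ≤ p) {k : ℕ} (hk : 1 ≤ k) (hNk : N * p ≤ k) :
    ∫ ω, (centredAdj P A ω ^ (2 * k)).trace ∂μ ≤ N * (walkConst * k) ^ k := by
  classical
  simp only [matrix_trace_pow]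
  rw [integral_finsetSum _ fun w _ => by
    split_ifs
    · exact h.integrable_prod w
    · exact integrable_zero _ _ _]
  calc _ ≤ ∑ w : Fin (2 * k + 1) → Fin N,
        if IsRecurrentWalk w then p ^ ((Finset.univ.image w).card - 1) else 0 := by
        refine Finset.sum_le_sum fun w _ => ?_
        by_cases hw : w 0 = w (Fin.last (2 * k))
        · simp only [hw, if_true]
          exact h.integral_prod_le hp hp1 hPp hw
        · simp only [hw, if_false, integral_zero]
          split_ifs <;> positivity
    _ ≤ N * (Finset.univ.filter fun w : Fin (2 * k + 1) → Fin (2 * k) =>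
          IsRecurrentWalk w).card := by
        rw [← Finset.sum_filter]
        refine sum_recurrentWalk_le hp ?_ (by omega)
        push_cast
        linarith
    _ ≤ _ := by
        gcongr
        exact card_recurrentWalk_le_pow hk

/-- The factor in the bound for the operator norm of a centred adjacency matrix. -/
noncomputable def concConst : ℝ := √(2 * (walkConst * Real.exp 2)) + 1

theorem one_le_concConst : 1 ≤ concConst := by
  unfold concConst
  linarith [Real.sqrt_nonneg (2 * (walkConst * Real.exp 2))]

/-- The adjacency matrix is within `O(√M)` of its expectation except with probability `1 / N`, where
`M` is any bound for the largest expected degree and for `log N`. -/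
theorem IsInhomogeneousErdosRenyi.measure_lt_norm_sub_le [IsProbabilityMeasure μ]
    (h : IsInhomogeneousErdosRenyi μ P A) {p M : ℝ}
    (hp : 0 ≤ p) (hp1 : p ≤ 1) (hPp : ∀ i j, P i j ≤ p) (hN : 1 ≤ N) (hM1 : 1 ≤ M)
    (hMp : N * p ≤ M) (hMlog : Real.log N ≤ M) :
    μ {ω | concConst * √M < ‖A ω - P‖} ≤ ENNReal.ofReal (1 / N) := by
  -- The exponent is a power of two, for which `‖X ^ k‖ = ‖X‖ ^ k` holds in a C⋆-algebra.
  obtain ⟨i, hi1, hi2⟩ := exists_nat_pow_near hM1 (one_lt_two : (1 : ℝ) < 2)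
  set k : ℕ := 2 ^ (i + 1) with hk
  have hkM : M ≤ (k : ℝ) := by rw [hk]; push_cast; exact hi2.le
  have hkM2 : (k : ℝ) ≤ 2 * M := by rw [hk, pow_succ]; push_cast; linarith
  have hk1 : 1 ≤ k := Nat.one_le_two_pow
  have hk0 : (0 : ℝ) < k := by exact_mod_cast hk1
  have hw := walkConst_pos
  have hN0 : (0 : ℝ) < N := by exact_mod_cast hN
  set c : ℝ := (walkConst * Real.exp 2 * k) ^ k with hc
  have hc0 : 0 < c := by positivity
  have hsub : {ω | concConst * √M < ‖A ω - P‖}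
      ⊆ {ω | c ≤ (centredAdj P A ω ^ (2 * k)).trace} := by
    intro ω hω
    simp only [Set.mem_ofPred_eq] at hω ⊢
    have h1 := h.norm_sub_le ω
    have h2 : 1 ≤ √M := Real.one_le_sqrt.mpr hM1
    have h3 : √(2 * (walkConst * Real.exp 2)) * √M ≤ ‖centredAdj P A ω‖ := by
      have : concConst * √M = √(2 * (walkConst * Real.exp 2)) * √M + √M := by
        rw [concConst]; ring
      linarith
    rw [← Real.sqrt_mul (by positivity)] at h3
    have h4 : walkConst * Real.exp 2 * k ≤ ‖centredAdj P A ω‖ ^ 2 := by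
      calc walkConst * Real.exp 2 * k ≤ walkConst * Real.exp 2 * (2 * M) := by gcongr
        _ = √(2 * (walkConst * Real.exp 2) * M) ^ 2 := by
            rw [Real.sq_sqrt (by positivity)]; ring
        _ ≤ _ := pow_le_pow_left₀ (Real.sqrt_nonneg _) h3 2
    have hsymm := centredAdj_transpose P A ω
    have hsa : IsSelfAdjoint (centredAdj P A ω) := by
      rw [IsSelfAdjoint, Matrix.star_eq_conjTranspose,
        Matrix.conjTranspose_eq_transpose_of_trivial, hsymm]
    calc c ≤ (‖centredAdj P A ω‖ ^ 2) ^ k := pow_le_pow_left₀ (by positivity) h4 k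
      _ = ‖centredAdj P A ω ^ k‖ ^ 2 := by
          rw [hk, hsa.norm_pow_two_pow, ← pow_mul, ← pow_mul, mul_comm]
      _ ≤ frobeniusNorm (centredAdj P A ω ^ k) ^ 2 :=
          pow_le_pow_left₀ (norm_nonneg _) (opNorm_le_frobeniusNorm _) 2
      _ = _ := (trace_pow_two_mul hsymm k).symm
  refine (measure_mono hsub).trans ?_
  rw [← ofReal_measureReal]
  refine ENNReal.ofReal_le_ofReal ?_
  have h1 := mul_meas_ge_le_integral_of_nonneg (μ := μ)
    (f := fun ω => (centredAdj P A ω ^ (2 * k)).trace)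
    (ae_of_all _ fun ω => by
      change 0 ≤ (centredAdj P A ω ^ (2 * k)).trace
      rw [trace_pow_two_mul (centredAdj_transpose P A ω)]
      positivity) (h.integrable_trace_pow _) c
  have h2 := h.integral_trace_pow_le hp hp1 hPp hk1 (hMp.trans hkM)
  have h3 : c = (walkConst * k) ^ k * Real.exp (2 * k) := by
    rw [hc, mul_comm (2 : ℝ), Real.exp_nat_mul, ← mul_pow]
    congr 1
    ring
  have h4 : (N : ℝ) * N ≤ Real.exp (2 * k) := by
    rw [two_mul, Real.exp_add]
    have : (N : ℝ) ≤ Real.exp k := by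
      rw [← Real.exp_log hN0]
      exact Real.exp_le_exp.mpr (hMlog.trans hkM)
    gcongr
  have h5 : c * μ.real {ω | c ≤ (centredAdj P A ω ^ (2 * k)).trace} ≤ N * (walkConst * k) ^ k :=
    h1.trans h2
  set z := μ.real {ω | c ≤ (centredAdj P A ω ^ (2 * k)).trace} with hz
  have hz0 : 0 ≤ z := measureReal_nonneg
  rw [h3, mul_comm (N : ℝ), mul_assoc] at h5
  have h6 := le_of_mul_le_mul_left h5 (by positivity)
  rw [le_div_iff₀ hN0]
  have h7 : (N : ℝ) * N * z ≤ N := (mul_le_mul_of_nonneg_right h4 hz0).trans h6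
  have h8 : (N : ℝ) * (z * N) ≤ N * 1 := by linarith
  exact le_of_mul_le_mul_left h8 hN0

end Concentration

/-! ### Error bounds for the estimator -/

section ErrorBounds

open scoped Matrix.Norms.L2Operator

theorem opNorm_submatrix_one_le {p q : ℕ} {f : Fin p → Fin q} (hf : Function.Injective f) :
    ‖((1 : Matrix (Fin q) (Fin q) ℝ).submatrix f id)‖ ≤ 1 := by
  set J := (1 : Matrix (Fin q) (Fin q) ℝ).submatrix f id with hJ
  have h1 : J * Jᵀ = 1 := by
    ext i j
    simp [hJ, Matrix.mul_apply, Matrix.one_apply, hf.eq_iff]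
  have h2 := Matrix.l2_opNorm_conjTranspose_mul_self Jᵀ
  rw [Matrix.conjTranspose_eq_transpose_of_trivial, Matrix.transpose_transpose, h1,
    opNorm_transpose] at h2
  have h3 : ‖(1 : Matrix (Fin p) (Fin p) ℝ)‖ ≤ 1 :=
    opNorm_le_one_of_symm_of_idem (by simp) (by simp)
  nlinarith [norm_nonneg J]

theorem opNorm_submatrix_le {p q p' q' : ℕ} (M : Matrix (Fin p) (Fin q) ℝ) {f : Fin p' → Fin p}
    {g : Fin q' → Fin q} (hf : Function.Injective f) (hg : Function.Injective g) :
    ‖M.submatrix f g‖ ≤ ‖M‖ := by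
  have h1 : M.submatrix f g = (1 : Matrix (Fin p) (Fin p) ℝ).submatrix f id * M
      * ((1 : Matrix (Fin q) (Fin q) ℝ).submatrix g id)ᵀ := by
    ext i j
    simp [Matrix.mul_apply, Matrix.one_apply]
  have h2 := opNorm_submatrix_one_le hg
  rw [← opNorm_transpose] at h2
  rw [h1]
  calc _ ≤ ‖(1 : Matrix (Fin p) (Fin p) ℝ).submatrix f id‖ * ‖M‖
        * ‖((1 : Matrix (Fin q) (Fin q) ℝ).submatrix g id)ᵀ‖ :=
        (Matrix.l2_opNorm_mul _ _).trans
          (mul_le_mul_of_nonneg_right (Matrix.l2_opNorm_mul _ _) (norm_nonneg _))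
    _ ≤ 1 * ‖M‖ * 1 := by
        gcongr
        exact opNorm_submatrix_one_le hf
    _ = ‖M‖ := by ring

theorem frobeniusNorm_sub_le {p q : ℕ} (M M' : Matrix (Fin p) (Fin q) ℝ) :
    frobeniusNorm (M - M') ≤ frobeniusNorm M + frobeniusNorm M' := by
  let := @Matrix.frobeniusNormedAddCommGroup (Fin p) (Fin q) ℝ _ _ _
  exact norm_sub_le M M'

theorem rank_estimate_le {n m K : ℕ} {A U V : Matrix (Fin n) (Fin n) ℝ} {d : Fin n → ℝ}
    (h : IsSVD A U d V) (B : Matrix (Fin n) (Fin m) ℝ) :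
    (Bᵀ * moorePenrose (truncatedSVD K U d V) * B).rank ≤ K :=
  (Matrix.rank_mul_le_left _ _).trans
    ((Matrix.rank_mul_le_right _ _).trans (rank_moorePenrose_truncatedSVD_le h K))

theorem rank_sub_le {p q : ℕ} (M M' : Matrix (Fin p) (Fin q) ℝ) :
    (M - M').rank ≤ M.rank + M'.rank := by
  have h : LinearMap.range (M - M').mulVecLin
      ≤ LinearMap.range M.mulVecLin ⊔ LinearMap.range M'.mulVecLin := by
    rintro _ ⟨x, rfl⟩
    rw [Matrix.mulVecLin_apply, Matrix.sub_mulVec]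
    exact Submodule.sub_mem _ (Submodule.mem_sup_left ⟨x, rfl⟩)
      (Submodule.mem_sup_right ⟨x, rfl⟩)
  exact (Submodule.finrank_mono h).trans (Submodule.finrank_add_le_finrank_add_finrank _ _)

/-- The error of the estimator on the event that `A₁₁` and `A` are within `a √(n p)` and `a √(N p)`
of their expectations, provided that `n p` is large. -/
theorem frobeniusNorm_estimate_sub_le {n m K : ℕ} {ψ a : ℝ} (hψ : 0 < ψ) (ha : 0 < a)
    {P A : Matrix (Fin (n + m)) (Fin (n + m)) ℝ} (hP : P.IsSymm)
    (hP01 : ∀ i j, P i j ∈ unitInterval) (hK : 1 ≤ K) (hr₁₁ : (block₁₁ P).rank = K)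
    (hr : P.rank = K) (hσ : 1 / ψ * (n * maxEntry P) ≤ singularValue K (block₁₁ P))
    (hn : 2 ≤ n) (hnp : 2 * ψ * a ≤ √(n * maxEntry P))
    (hA₁₁ : ‖block₁₁ A - block₁₁ P‖ ≤ a * √(n * maxEntry P))
    (hA : ‖A - P‖ ≤ a * √((n + m : ℕ) * maxEntry P))
    {R : Matrix (Fin m) (Fin m) ℝ} (hR : IsLowRankEstimate K (block₁₁ A) (block₁₂ A) R) :
    frobeniusNorm (R - block₂₂ P)
      ≤ √2 * (10 * ψ ^ 2 * a + 6 * ψ * a + 2 * ψ * a ^ 2 / Real.log 2)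
        * rate (n + m) n K (maxEntry P) := by
  obtain ⟨U, d, V, hsvd, rfl⟩ := hR
  set p := maxEntry P with hp
  set u := √(n * p) with hu
  have hp0 : 0 ≤ p := maxEntry_nonneg fun i j => (hP01 i j).1
  have hn0 : (0 : ℝ) < n := by exact_mod_cast (by omega : 0 < n)
  have hu0 : 0 < u := lt_of_lt_of_le (by positivity) hnp
  have hu2 : u ^ 2 = n * p := Real.sq_sqrt (by positivity)
  have hp0' : 0 < p := by
    rcases hp0.eq_or_lt with h | h
    · rw [← h, mul_zero] at hu2; exact absurd hu2 (by positivity)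
    · exact h
  set N : ℝ := ((n + m : ℕ) : ℝ) with hN
  set s := N / n with hs
  have hnN : (n : ℝ) ≤ N := by rw [hN]; exact_mod_cast Nat.le_add_right n m
  have hmN : (m : ℝ) ≤ N := by rw [hN]; exact_mod_cast Nat.le_add_left m n
  have hN0 : 0 < N := hn0.trans_le hnN
  have hs1 : 1 ≤ s := (one_le_div hn0).mpr hnN
  have hsN : s * n = N := div_mul_cancel₀ _ hn0.ne'
  have hNp : √(N * p) = √s * u := by
    rw [hu, ← Real.sqrt_mul (by positivity), ← mul_assoc, hsN]
  have hss : √s ^ 2 = s := Real.sq_sqrt (by positivity)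
  -- The smallness of the noise, relative to the signal.
  have hau : a * u ≤ u ^ 2 / (2 * ψ) := by
    rw [le_div_iff₀ (by positivity)]
    nlinarith
  -- The `K`-th singular value of `A₁₁` is bounded below.
  have hfin : Module.finrank ℝ (LinearMap.range (Matrix.toEuclideanLin (block₁₁ P)ᵀ)) = K := by
    rw [finrank_range_toEuclideanLin, Matrix.rank_transpose, hr₁₁]
  have hσ' : u ^ 2 / ψ ≤ singularValue K (block₁₁ P) := by
    rw [hu2]; refine le_trans (le_of_eq ?_) hσ; ring
  have hd : ∀ i : Fin n, (i : ℕ) < K → u ^ 2 / (2 * ψ) ≤ d i := by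
    intro i hi
    have h1 := hsvd.sub_le_of_subspace (B := block₁₁ P) _
      (fun x hx => singularValue_mul_norm_le (block₁₁ P) hK hr₁₁ x hx) i (by rw [hfin]; exact hi)
    have h2 : u ^ 2 / ψ = u ^ 2 / (2 * ψ) + u ^ 2 / (2 * ψ) := by field_simp; ring
    linarith
  have hd' : ∀ i : Fin n, K ≤ i → d i ≤ a * u := fun i hi =>
    (hsvd.le_norm_sub_of_rank_le i (hr₁₁.le.trans hi)).trans hA₁₁
  have hX : ‖moorePenrose (truncatedSVD K U d V)‖ ≤ 2 * ψ / u ^ 2 := by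
    refine (hsvd.norm_moorePenrose_truncatedSVD_le K (by positivity) hd).trans (le_of_eq ?_)
    rw [one_div_div]
  have hF : ‖block₁₁ P - truncatedSVD K U d V‖ ≤ 2 * (a * u) := by
    have h1 := hsvd.norm_sub_truncatedSVD_le K (by positivity) hd'
    have h2 := norm_sub_le_norm_sub_add_norm_sub (block₁₁ P) (block₁₁ A) (truncatedSVD K U d V)
    rw [norm_sub_rev (block₁₁ P) (block₁₁ A)] at h2
    linarith
  obtain ⟨Z, hZ12, hZ22, hZ⟩ := exists_block_factorization hP hK hr₁₁ hr
  have hZn : ‖Z‖ ≤ ψ * √s := by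
    have h1 : ‖block₁₂ P‖ ≤ √(n * m) * p :=
      (opNorm_le_frobeniusNorm _).trans (frobeniusNorm_le_of_entries _ hp0 fun i j =>
        (abs_of_nonneg (hP01 (Fin.castAdd m i) (Fin.natAdd n j)).1).le.trans (le_maxEntry P _ _))
    have h2 : √((n : ℝ) * m) ≤ n * √s := by
      rw [← Real.sqrt_sq hn0.le, ← Real.sqrt_mul (by positivity), Real.sqrt_sq hn0.le]
      refine Real.sqrt_le_sqrt ?_
      have : (n : ℝ) ^ 2 * s = n * N := by rw [← hsN]; ring
      rw [this]
      gcongr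
    have h3 : u ^ 2 / ψ * ‖Z‖ ≤ n * √s * p :=
      ((mul_le_mul_of_nonneg_right hσ' (norm_nonneg _)).trans hZ).trans
        (h1.trans (mul_le_mul_of_nonneg_right h2 hp0))
    rw [hu2, div_mul_eq_mul_div, div_le_iff₀ hψ] at h3
    have h4 : (n : ℝ) * p * ‖Z‖ ≤ n * p * (ψ * √s) := by linarith
    exact le_of_mul_le_mul_left h4 (by positivity)
  have hE : ‖block₁₂ A - block₁₂ P‖ ≤ a * (√s * u) := by
    rw [← hNp]
    exact (opNorm_submatrix_le (A - P) (Fin.castAdd_injective n m)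
      (Fin.natAdd_injective m n)).trans hA
  have hsymm : (block₁₁ P)ᵀ = block₁₁ P := by
    ext i j
    exact hP.apply _ _
  have hmain := norm_quadratic_sub_le hsymm
    (isMoorePenrose_moorePenrose (truncatedSVD K U d V)) hF hX hZn hE
  rw [hZ12, add_sub_cancel, hZ22] at hmain
  have hxf : 2 * ψ / u ^ 2 * (2 * (a * u)) ≤ 2 := by
    rw [div_mul_eq_mul_div, div_le_iff₀ (by positivity)]
    rw [le_div_iff₀ (by positivity)] at hau
    linarith
  have hop : ‖(block₁₂ A)ᵀ * moorePenrose (truncatedSVD K U d V) * block₁₂ A - block₂₂ P‖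
      ≤ (10 * ψ ^ 2 * a + 6 * ψ * a) * (s * u) + 2 * ψ * a ^ 2 * s := by
    refine hmain.trans ?_
    have h1 : (ψ * √s) ^ 2 * (3 * (2 * (a * u)) + (2 * (a * u)) ^ 2 * (2 * ψ / u ^ 2))
        ≤ 10 * ψ ^ 2 * a * (s * u) := by
      calc _ = ψ ^ 2 * √s ^ 2 * (2 * (a * u))
            * (3 + 2 * ψ / u ^ 2 * (2 * (a * u))) := by ring
        _ ≤ ψ ^ 2 * √s ^ 2 * (2 * (a * u)) * (3 + 2) := by gcongr
        _ = _ := by rw [hss]; ring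
    have h2 : 2 * (ψ * √s) * (a * (√s * u)) * (1 + 2 * ψ / u ^ 2 * (2 * (a * u)))
        ≤ 6 * ψ * a * (s * u) := by
      calc _ ≤ 2 * (ψ * √s) * (a * (√s * u)) * (1 + 2) := by gcongr
        _ = 6 * ψ * a * (√s ^ 2 * u) := by ring
        _ = _ := by rw [hss]
    have h3 : (a * (√s * u)) ^ 2 * (2 * ψ / u ^ 2) = 2 * ψ * a ^ 2 * s := by
      rw [mul_pow, mul_pow, hss]
      field_simp
    linarith
  have hrank : ((block₁₂ A)ᵀ * moorePenrose (truncatedSVD K U d V) * block₁₂ A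
      - block₂₂ P).rank ≤ 2 * K := by
    refine (rank_sub_le _ _).trans ?_
    have h1 := rank_estimate_le (K := K) hsvd (block₁₂ A)
    have h2 : (block₂₂ P).rank ≤ K := by
      rw [← hZ22]
      exact (Matrix.rank_mul_le_left _ _).trans ((Matrix.rank_mul_le_right _ _).trans hr₁₁.le)
    omega
  have hK0 : (1 : ℝ) ≤ K := by exact_mod_cast hK
  have hlog2 : 0 < Real.log 2 := Real.log_pos one_lt_two
  have hlogn : Real.log 2 ≤ Real.log n := Real.log_le_log two_pos (by exact_mod_cast hn)
  have hsu : s * u ≤ s ^ (3 / 2 : ℝ) * √(K * N * p) := by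
    have h1 : s ≤ s ^ (3 / 2 : ℝ) := by
      conv_lhs => rw [← Real.rpow_one s]
      exact Real.rpow_le_rpow_of_exponent_le hs1 (by norm_num)
    have h2 : u ≤ √(K * N * p) := by
      refine Real.sqrt_le_sqrt ?_
      have : (n : ℝ) ≤ K * N := by nlinarith
      gcongr
    gcongr
  have hsl : s ≤ N ^ 2 / n ^ 2 * Real.log n / Real.log 2 := by
    rw [le_div_iff₀ hlog2, ← div_pow]
    have : s ≤ s ^ 2 := le_self_pow₀ hs1 two_ne_zero
    gcongr
  have hsl0 : 0 ≤ N ^ 2 / n ^ 2 * Real.log n := by positivity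
  have hsu0 : 0 ≤ s ^ (3 / 2 : ℝ) * √(K * N * p) := by positivity
  have hfinal : (10 * ψ ^ 2 * a + 6 * ψ * a) * (s * u) + 2 * ψ * a ^ 2 * s
      ≤ (10 * ψ ^ 2 * a + 6 * ψ * a + 2 * ψ * a ^ 2 / Real.log 2)
        * (s ^ (3 / 2 : ℝ) * √(K * N * p) + N ^ 2 / n ^ 2 * Real.log n) := by
    have h1 : (10 * ψ ^ 2 * a + 6 * ψ * a) * (s * u)
        ≤ (10 * ψ ^ 2 * a + 6 * ψ * a) * (s ^ (3 / 2 : ℝ) * √(K * N * p)) := by gcongr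
    have h2 : 2 * ψ * a ^ 2 * s
        ≤ 2 * ψ * a ^ 2 / Real.log 2 * (N ^ 2 / n ^ 2 * Real.log n) := by
      calc _ ≤ 2 * ψ * a ^ 2 * (N ^ 2 / n ^ 2 * Real.log n / Real.log 2) := by gcongr
        _ = _ := by ring
    have h3 : 0 ≤ (10 * ψ ^ 2 * a + 6 * ψ * a) * (N ^ 2 / n ^ 2 * Real.log n) := by positivity
    have h4 : 0 ≤ 2 * ψ * a ^ 2 / Real.log 2 * (s ^ (3 / 2 : ℝ) * √(K * N * p)) := by positivity
    linarith
  have hrate : rate (n + m) n K p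
      = √(K : ℝ) * (s ^ (3 / 2 : ℝ) * √(K * N * p) + N ^ 2 / n ^ 2 * Real.log n) := rfl
  rw [hrate]
  refine (frobeniusNorm_le_sqrt_rank_mul _).trans ?_
  calc _ ≤ √(2 * K) * ((10 * ψ ^ 2 * a + 6 * ψ * a) * (s * u) + 2 * ψ * a ^ 2 * s) := by
        gcongr
        exact_mod_cast hrank
    _ ≤ √(2 * K) * ((10 * ψ ^ 2 * a + 6 * ψ * a + 2 * ψ * a ^ 2 / Real.log 2)
        * (s ^ (3 / 2 : ℝ) * √(K * N * p) + N ^ 2 / n ^ 2 * Real.log n)) := by gcongr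
    _ = _ := by rw [Real.sqrt_mul (by norm_num)]; ring

/-- There are finitely many `0`-`1` matrices of a given size, so that the norms of their
pseudoinverses are bounded. -/
theorem exists_forall_norm_moorePenrose_le (n : ℕ) :
    ∃ β : ℝ, 0 ≤ β ∧ ∀ A : Matrix (Fin n) (Fin n) ℝ, (∀ i j, A i j = 0 ∨ A i j = 1) →
      ‖moorePenrose A‖ ≤ β := by
  classical
  refine ⟨∑ B : Fin n → Fin n → Bool,
    ‖moorePenrose (Matrix.of fun i j => if B i j then (1 : ℝ) else 0)‖,
    Finset.sum_nonneg fun _ _ => norm_nonneg _, fun A hA => ?_⟩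
  have h1 : A = Matrix.of fun i j => if decide (A i j = 1) then (1 : ℝ) else 0 := by
    ext i j
    rcases hA i j with h | h <;> simp [h]
  have h2 := Finset.single_le_sum (f := fun B : Fin n → Fin n → Bool =>
    ‖moorePenrose (Matrix.of fun i j => if B i j then (1 : ℝ) else 0)‖)
    (fun _ _ => norm_nonneg _) (Finset.mem_univ fun i j => decide (A i j = 1))
  simp only [← h1] at h2
  exact h2

/-- For fixed `n` the error bound holds surely once the network is large, because its right-hand
side is quadratic in the size of the network and its left-hand side is at most linear. -/
theorem exists_forall_frobeniusNorm_estimate_sub_le_rate {n : ℕ} (hn : 2 ≤ n) :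
    ∃ N₀ : ℕ, ∀ (m K : ℕ) (P A : Matrix (Fin (n + m)) (Fin (n + m)) ℝ), N₀ ≤ n + m → 1 ≤ K →
      (∀ i j, P i j ∈ unitInterval) → (∀ i j, A i j = 0 ∨ A i j = 1) →
      ∀ R, IsLowRankEstimate K (block₁₁ A) (block₁₂ A) R →
        frobeniusNorm (R - block₂₂ P) ≤ rate (n + m) n K (maxEntry P) := by
  obtain ⟨β, hβ, hmp⟩ := exists_forall_norm_moorePenrose_le n
  have hn0 : (0 : ℝ) < n := by exact_mod_cast (by omega : 0 < n)
  have hlog : 0 < Real.log n := Real.log_pos (by exact_mod_cast (by omega : 1 < n))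
  obtain ⟨N₀, hN₀⟩ := exists_nat_ge ((n * β + 1) * n ^ 2 / Real.log n)
  refine ⟨N₀, fun m K P A hNm hK hP hA R hR => ?_⟩
  obtain ⟨U, d, V, hsvd, rfl⟩ := hR
  set N : ℝ := ((n + m : ℕ) : ℝ) with hN
  have hmN : (m : ℝ) ≤ N := by rw [hN]; exact_mod_cast Nat.le_add_left m n
  have hNN : (N₀ : ℝ) ≤ N := by rw [hN]; exact_mod_cast hNm
  have hK0 : (1 : ℝ) ≤ K := by exact_mod_cast hK
  have hK1 : 1 ≤ √(K : ℝ) := Real.one_le_sqrt.mpr hK0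
  have h12 : ‖block₁₂ A‖ ≤ √(n * m) := by
    have := (opNorm_le_frobeniusNorm (block₁₂ A)).trans
      (frobeniusNorm_le_of_entries _ zero_le_one fun i j => by
        rcases hA (Fin.castAdd m i) (Fin.natAdd n j) with h | h <;>
          simp [block₁₂, h])
    simpa using this
  have h22 : frobeniusNorm (block₂₂ P) ≤ m := by
    have := frobeniusNorm_le_of_entries (block₂₂ P) zero_le_one fun i j =>
      (abs_of_nonneg (hP (Fin.natAdd n i) (Fin.natAdd n j)).1).le.trans (hP _ _).2
    rwa [Real.sqrt_mul_self (by positivity), mul_one] at this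
  have hop : ‖(block₁₂ A)ᵀ * moorePenrose (truncatedSVD K U d V) * block₁₂ A‖ ≤ n * m * β := by
    have hX := (hsvd.norm_moorePenrose_truncatedSVD_le_norm_moorePenrose K).trans
      (hmp _ fun i j => hA _ _)
    have h12' : ‖(block₁₂ A)ᵀ‖ ≤ √(n * m) := by rwa [opNorm_transpose]
    calc _ ≤ ‖(block₁₂ A)ᵀ‖ * ‖moorePenrose (truncatedSVD K U d V)‖ * ‖block₁₂ A‖ :=
          (Matrix.l2_opNorm_mul _ _).trans
            (mul_le_mul_of_nonneg_right (Matrix.l2_opNorm_mul _ _) (norm_nonneg _))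
      _ ≤ √(n * m) * β * √(n * m) := by gcongr
      _ = √((n : ℝ) * m) ^ 2 * β := by ring
      _ = n * m * β := by rw [Real.sq_sqrt (by positivity)]
  have hfr : frobeniusNorm ((block₁₂ A)ᵀ * moorePenrose (truncatedSVD K U d V) * block₁₂ A)
      ≤ √(K : ℝ) * (n * m * β) := by
    refine (frobeniusNorm_le_sqrt_rank_mul _).trans ?_
    gcongr
    exact_mod_cast rank_estimate_le hsvd (block₁₂ A)
  have hrate : rate (n + m) n K (maxEntry P) = √(K : ℝ) * ((N / n) ^ (3 / 2 : ℝ)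
      * √(K * N * maxEntry P) + N ^ 2 / n ^ 2 * Real.log n) := rfl
  have hbig : (n * β + 1) ≤ N / n ^ 2 * Real.log n := by
    have := hN₀.trans hNN
    rw [div_le_iff₀ hlog] at this
    rw [div_mul_eq_mul_div, le_div_iff₀ (by positivity)]
    exact this
  have hN0 : 0 ≤ N := (Nat.cast_nonneg m).trans hmN
  rw [hrate]
  calc _ ≤ √(K : ℝ) * (n * m * β) + m := (frobeniusNorm_sub_le _ _).trans (add_le_add hfr h22)
    _ ≤ √(K : ℝ) * (n * m * β) + √(K : ℝ) * m :=
        add_le_add le_rfl (le_mul_of_one_le_left (by positivity) hK1)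
    _ = √(K : ℝ) * (m * (n * β + 1)) := by ring
    _ ≤ √(K : ℝ) * (N * (N / n ^ 2 * Real.log n)) := by gcongr
    _ = √(K : ℝ) * (N ^ 2 / n ^ 2 * Real.log n) := by ring
    _ ≤ _ := by
        gcongr
        exact le_add_of_nonneg_left (by positivity)

end ErrorBounds

/-! ### Combining the two regimes -/

section Assembly

open scoped Matrix.Norms.L2Operator

/-- Sparse networks with `n p ≥ c log n` also satisfy `N p ≥ c log N`, as `log x / x` decreases. -/
theorem mul_log_le_of_le {n N : ℕ} (hn : 3 ≤ n) (hnN : n ≤ N) {c p : ℝ} (hc : 0 ≤ c)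
    (h : c * Real.log n ≤ n * p) : c * Real.log N ≤ N * p := by
  have hn0 : (0 : ℝ) < n := by exact_mod_cast (by omega : 0 < n)
  have hN0 : (0 : ℝ) < N := by exact_mod_cast (by omega : 0 < N)
  have he : Real.exp 1 ≤ n := Real.exp_one_lt_three.le.trans (by exact_mod_cast hn)
  have hnN' : (n : ℝ) ≤ N := by exact_mod_cast hnN
  have h1 : Real.log N / N ≤ Real.log n / n :=
    Real.log_div_self_antitoneOn he (he.trans hnN') hnN'
  have h2 : c * (Real.log n / n) ≤ p := by
    rw [← mul_div_assoc, div_le_iff₀ hn0, mul_comm p]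
    exact h
  have h3 : c * (Real.log N / N) ≤ p := (mul_le_mul_of_nonneg_left h1 hc).trans h2
  rw [← mul_div_assoc, div_le_iff₀ hN0, mul_comm p] at h3
  exact h3

theorem IsInhomogeneousErdosRenyi.measure_lt_norm_sub_le_of_log_le {N : ℕ} {Ω : Type*}
    [MeasurableSpace Ω] {μ : Measure Ω} [IsProbabilityMeasure μ]
    {P : Matrix (Fin N) (Fin N) ℝ} {A : Ω → Matrix (Fin N) (Fin N) ℝ}
    (h : IsInhomogeneousErdosRenyi μ P A) {p c : ℝ} (hc : 0 < c) (hp : 0 ≤ p) (hp1 : p ≤ 1)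
    (hPp : ∀ i j, P i j ≤ p) (hN : 3 ≤ N) (hlog : c * Real.log N ≤ N * p) :
    μ {ω | concConst * √(1 + 1 / c) * √(N * p) < ‖A ω - P‖} ≤ ENNReal.ofReal (1 / N) := by
  have hNp : 0 ≤ N * p := by positivity
  have h1 : N * p ≤ (1 + 1 / c) * (N * p) :=
    le_mul_of_one_le_left hNp (le_add_of_nonneg_right (by positivity))
  have h2 : Real.log N ≤ (1 + 1 / c) * (N * p) := by
    have h3 : Real.log N ≤ 1 / c * (N * p) := by
      rw [one_div_mul_eq_div, le_div_iff₀ hc, mul_comm]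
      exact hlog
    linarith
  have h4 : 1 ≤ Real.log N := by
    rw [Real.le_log_iff_exp_le (by exact_mod_cast (by omega : 0 < N))]
    exact Real.exp_one_lt_three.le.trans (by exact_mod_cast hN)
  have h5 := h.measure_lt_norm_sub_le hp hp1 hPp (by omega) (h4.trans h2) h1 h2
  rwa [Real.sqrt_mul (by positivity), ← mul_assoc] at h5

end Assembly

end EgoLowRank

theorem theorem1 (ψ c₁ c₂ : ℝ) (hψ : 0 < ψ) (hc₁ : 0 < c₁) (hc₂ : 0 < c₂) :
    ∃ C : ℝ, 0 < C ∧
      ∀ (n m K : ℕ → ℕ) (P : ∀ t, Matrix (Fin (n t + m t)) (Fin (n t + m t)) ℝ)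
        (Ω : ℕ → Type*) [∀ t, MeasurableSpace (Ω t)] (μ : ∀ t, Measure (Ω t))
        [∀ t, IsProbabilityMeasure (μ t)]
        (A : ∀ t, Ω t → Matrix (Fin (n t + m t)) (Fin (n t + m t)) ℝ),
        Tendsto (fun t => n t + m t) atTop atTop →
        (∀ t, EgoLowRank.IsInhomogeneousErdosRenyi (μ t) (P t) (A t)) →
        (∀ t, 1 ≤ K t) →
        (∀ t, (EgoLowRank.block₁₁ (P t)).rank = K t ∧ (P t).rank = K t) →
        (∀ t, EgoLowRank.IsWellConditioned ψ (K t) (P t)) →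
        (∀ t, c₁ * Real.log (n t) ≤ (n t : ℝ) * EgoLowRank.maxEntry (P t)) →
        (∀ t, (K t : ℝ) ≤ c₂ * √(Real.log (n t))) →
        Tendsto (fun t => μ t {ω | ∀ R : Matrix (Fin (m t)) (Fin (m t)) ℝ,
            EgoLowRank.IsLowRankEstimate (K t) (EgoLowRank.block₁₁ (A t ω))
              (EgoLowRank.block₁₂ (A t ω)) R →
            EgoLowRank.frobeniusNorm (R - EgoLowRank.block₂₂ (P t)) ≤
                C * EgoLowRank.rate (n t + m t) (n t) (K t) (EgoLowRank.maxEntry (P t)) ∧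
              EgoLowRank.frobeniusNorm (EgoLowRank.clip R - EgoLowRank.block₂₂ (P t)) ≤
                C * EgoLowRank.rate (n t + m t) (n t) (K t) (EgoLowRank.maxEntry (P t))})
          atTop (𝓝 1) := by
  open EgoLowRank in
  open scoped Matrix.Norms.L2Operator in
  set a : ℝ := concConst * √(1 + 1 / c₁) with ha
  have ha0 : 0 < a := by
    have := one_le_concConst
    positivity
  set C₀ : ℝ := √2 * (10 * ψ ^ 2 * a + 6 * ψ * a + 2 * ψ * a ^ 2 / Real.log 2) with hC₀
  refine ⟨max 1 C₀, by positivity, ?_⟩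
  intro n m K P Ω _ μ _ A hN hER hK hrank hcond hnp hKlog
  have hP01 : ∀ t i j, P t i j ∈ unitInterval := fun t => (hER t).prob_mem
  have hp0 : ∀ t, 0 ≤ maxEntry (P t) := fun t => maxEntry_nonneg fun i j => (hP01 t i j).1
  have hp1 : ∀ t, maxEntry (P t) ≤ 1 := fun t => maxEntry_le_one fun i j => (hP01 t i j).2
  -- The logarithm of `0` and of `1` being `0`, the bound on the rank rules out `n ≤ 1`.
  have hn2 : ∀ t, 2 ≤ n t := by
    intro t
    by_contra! h
    have h1 : Real.log (n t) = 0 := by interval_cases n t <;> simp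
    have h2 := hKlog t
    rw [h1, Real.sqrt_zero, mul_zero] at h2
    have h3 : (1 : ℝ) ≤ K t := by exact_mod_cast hK t
    linarith
  have hrate0 : ∀ t, 0 ≤ rate (n t + m t) (n t) (K t) (maxEntry (P t)) := by
    intro t
    have := hp0 t
    unfold rate
    positivity
  -- It suffices to bound the error of the untruncated estimator.
  have hgood : ∀ t ω, (∀ R, IsLowRankEstimate (K t) (block₁₁ (A t ω)) (block₁₂ (A t ω)) R →
      frobeniusNorm (R - block₂₂ (P t))
        ≤ max 1 C₀ * rate (n t + m t) (n t) (K t) (maxEntry (P t))) →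
      ω ∈ {ω | ∀ R : Matrix (Fin (m t)) (Fin (m t)) ℝ,
            IsLowRankEstimate (K t) (block₁₁ (A t ω)) (block₁₂ (A t ω)) R →
            frobeniusNorm (R - block₂₂ (P t)) ≤
                max 1 C₀ * rate (n t + m t) (n t) (K t) (maxEntry (P t)) ∧
              frobeniusNorm (clip R - block₂₂ (P t)) ≤
                max 1 C₀ * rate (n t + m t) (n t) (K t) (maxEntry (P t))} :=
    fun t ω h R hR => ⟨h R hR,
      (frobeniusNorm_clip_sub_le R _ fun i j => hP01 t _ _).trans (h R hR)⟩
  refine tendsto_order.mpr ⟨fun b hb => ?_, fun b hb =>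
    Eventually.of_forall fun t => prob_le_one.trans_lt hb⟩
  obtain ⟨b', hb0, hb', rfl⟩ : ∃ b' : ℝ, 0 ≤ b' ∧ b' < 1 ∧ b = ENNReal.ofReal b' := by
    refine ⟨b.toReal, ENNReal.toReal_nonneg, ?_,
      (ENNReal.ofReal_toReal (hb.trans_le le_top).ne).symm⟩
    exact (ENNReal.toReal_lt_toReal (hb.trans_le le_top).ne ENNReal.one_ne_top).mpr hb
  -- Beyond `n₁` the concentration bound applies with failure probability less than `1 - b'`.
  obtain ⟨n₁, hn₁⟩ : ∃ n₁ : ℕ, ∀ q : ℕ, n₁ ≤ q →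
      3 ≤ q ∧ 2 / (1 - b') < (q : ℝ) ∧ (2 * ψ * a) ^ 2 / c₁ ≤ Real.log q := by
    have h1 : ∀ᶠ q : ℕ in atTop, 2 / (1 - b') < (q : ℝ) :=
      tendsto_natCast_atTop_atTop.eventually_gt_atTop _
    have h2 : ∀ᶠ q : ℕ in atTop, (2 * ψ * a) ^ 2 / c₁ ≤ Real.log q :=
      (Real.tendsto_log_atTop.comp tendsto_natCast_atTop_atTop).eventually_ge_atTop _
    exact eventually_atTop.mp ((eventually_ge_atTop 3).and (h1.and h2))
  -- Below `n₁` there are finitely many cases, each of them deterministic for large `N`.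
  choose N₀ hN₀ using fun q : {q : ℕ // 2 ≤ q} =>
    exists_forall_frobeniusNorm_estimate_sub_le_rate q.2
  have hev : ∀ᶠ t in atTop, ∀ q ∈ Finset.range n₁, ∀ hq : 2 ≤ q, N₀ ⟨q, hq⟩ ≤ n t + m t := by
    rw [Filter.eventually_all_finset]
    intro q _
    by_cases hq : 2 ≤ q
    · filter_upwards [hN.eventually_ge_atTop (N₀ ⟨q, hq⟩)] with t ht _
      exact ht
    · exact Eventually.of_forall fun t h => absurd h hq
  filter_upwards [hev] with t ht
  rcases lt_or_ge (n t) n₁ with hlt | hge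
  · refine hb.trans_le ?_
    rw [← measure_univ (μ := μ t)]
    refine measure_mono fun ω _ => hgood t ω fun R hR => ?_
    refine (hN₀ ⟨n t, hn2 t⟩ (m t) (K t) (P t) (A t ω) (ht _ (Finset.mem_range.mpr hlt) (hn2 t))
      (hK t) (hP01 t) ((hER t).adj_mem ω) R hR).trans ?_
    exact le_mul_of_one_le_left (hrate0 t) (le_max_left _ _)
  · obtain ⟨hn3, hnb, hnlog⟩ := hn₁ _ hge
    have hnt0 : (0 : ℝ) < n t := by exact_mod_cast (by omega : 0 < n t)
    set B₁ := {ω | a * √(n t * maxEntry (P t)) < ‖block₁₁ (A t ω) - block₁₁ (P t)‖}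
    set B₂ := {ω | a * √((n t + m t : ℕ) * maxEntry (P t)) < ‖A t ω - P t‖}
    have hB₁ : μ t B₁ ≤ ENNReal.ofReal (1 / n t) :=
      (hER t).block₁₁.measure_lt_norm_sub_le_of_log_le hc₁ (hp0 t) (hp1 t)
        (fun i j => le_maxEntry (P t) _ _) hn3 (hnp t)
    have hB₂ : μ t B₂ ≤ ENNReal.ofReal (1 / n t) := by
      refine ((hER t).measure_lt_norm_sub_le_of_log_le hc₁ (hp0 t) (hp1 t)
        (fun i j => le_maxEntry (P t) _ _) (by omega)
        (mul_log_le_of_le hn3 (Nat.le_add_right _ _) hc₁.le (hnp t))).trans ?_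
      refine ENNReal.ofReal_le_ofReal (one_div_le_one_div_of_le hnt0 ?_)
      exact_mod_cast Nat.le_add_right _ _
    have hlarge : 2 * ψ * a ≤ √(n t * maxEntry (P t)) := by
      refine Real.le_sqrt_of_sq_le (le_trans ?_ (hnp t))
      rw [div_le_iff₀ hc₁] at hnlog
      linarith
    have hcover : Set.univ ⊆ _ ∪ (B₁ ∪ B₂) := fun ω _ => by
      by_cases h1 : ω ∈ B₁
      · exact Or.inr (Or.inl h1)
      by_cases h2 : ω ∈ B₂
      · exact Or.inr (Or.inr h2)
      refine Or.inl (hgood t ω fun R hR => ?_)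
      refine (frobeniusNorm_estimate_sub_le hψ ha0 (hER t).prob_symm (hP01 t) (hK t) (hrank t).1
        (hrank t).2 (hcond t).lower₁₁ (hn2 t) hlarge (not_lt.mp h1) (not_lt.mp h2) hR).trans ?_
      exact mul_le_mul_of_nonneg_right (le_max_right _ _) (hrate0 t)
    have hone := (measure_mono hcover).trans ((measure_union_le (μ := μ t) _ _).trans
      (add_le_add le_rfl ((measure_union_le B₁ B₂).trans (add_le_add hB₁ hB₂))))
    rw [measure_univ, ← ENNReal.ofReal_add (by positivity) (by positivity)] at hone
    by_contra! hle
    have h2 := hone.trans (add_le_add hle le_rfl)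
    have h3 : 1 / (n t : ℝ) + 1 / n t < 1 - b' := by
      rw [div_lt_iff₀ (by linarith)] at hnb
      rw [← add_div, div_lt_iff₀ hnt0]
      linarith
    have h4 : ENNReal.ofReal b' + ENNReal.ofReal (1 / (n t : ℝ) + 1 / n t) < 1 := by
      rw [← ENNReal.ofReal_add hb0 (by positivity), ENNReal.ofReal_lt_one]
      linarith
    exact absurd h2 (not_le.mpr h4)
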